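/- **Setting.** Let $d,\kappa\ge 1$. A tile is a pair $T=(A,i)$ with $A\subset\mathbb R^d$ a nonempty compact set that is the closure of its interior and $i\in\{1,\dots,\kappa\}$ its colour; $g+T=(g+A,i)$. A tiling is a set of tiles covering $\mathbb R^d$, distinct tiles having disjoint interiors and tiles of equal colour being translates of each other; it is repetitive if the translates of each of its finite patches occur relatively densely. Let $\phi:\mathbb R^d\to\mathbb R^d$ be linear and expansive (for some metric inducing the usual topology it expands distances by a factor $c>1$). A tile-substitution $\omega$ with map $\phi$ is given by prototiles $T_i=(A_i,i)$ and finite sets $\mathcal D_{ij}\subset\mathbb R^d$ such that $\phi A_j=\bigcup_i(\mathcal D_{ij}+A_i)$, the sets $u+A_i$ ($u\in\mathcal D_{ij}$, $i\le\kappa$) having pairwise disjoint interiors, and $\omega(x+T_j)=\{\phi x+u+T_i: u\in\mathcal D_{ij},\ i\le\kappa\}$. It is primitive if some positive power of the matrix $(\#\mathcal D_{ij})$ has only positive entries. Let $\mathcal T$ be a repetitive tiling by translates of the prototiles of a primitive $\omega$, with $\omega(\mathcal T)=\mathcal T$. A tile map $\gamma:\mathcal T\to\mathcal T$ selects a tile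 $\gamma T\in\omega(T)$, in the same relative position for tiles of the same colour. The control point $c(T)$ is defined by $\{c(T)\}=\bigcap_{m\ge0}\phi^{-m}(\gamma^mT)$; $\mathcal C_i$ is the set of control points of the tiles of colour $i$, $\mathcal C=(\mathcal C_i)_{i\le\kappa}$, and $\Xi=\bigcup_i(\mathcal C_i-\mathcal C_i)$. Let $\Phi$ be the $\kappa$-set substitution of $\mathcal C$: $\Phi(X)_i=\bigcup_j(\phi X_j+\mathcal D'_{ij})$, where $\mathcal D'_{ij}$ is the set of vectors $c(T')-\phi c(T)$ with $T\in\mathcal T$ of colour $j$ and $T'\in\omega(T)$ of colour $i$; thus $\Phi(\mathcal C)=\mathcal C$. **Assumptions on $\phi$.** $\phi$ is diagonalizable over $\mathbb C$; its eigenvalues are algebraic integers, are algebraically conjugate to each other, and all have the same multiplicity $J$; and $\phi$ is unimodular: its minimal polynomial over $\mathbb Q$ has constant term $\pm1$. **The cut-and-project scheme.** For a finite conjugation-invariant set $S\subset\mathbb C$ let $B_S$ be the real block-diagonal matrix with a block $(\lambda)$ for each real $\lambda\in S$ and a block $\begin{pmatrix}a&-b\\b&a\end{pmatrix}$ for each pair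 $a\pm ib\in S$, $b>0$. Let $S$ be the set of eigenvalues of $\phi$ and $S'$ the set of the other roots of its minimal polynomial over $\mathbb Q$. In suitable linear coordinates $\phi$ is the direct sum of $J$ copies of $B_S$; let $D$ be the direct sum of $J$ copies of $B_{S'}$, acting on the Euclidean space $\mathbb G=(\mathbb R^{|S'|})^J$. Let $\alpha_j$ (resp. $\beta_j$) be the vector with all coordinates $1$ in the $j$-th of the $J$ blocks and $0$ elsewhere. Put $$L=\mathbb Z[\phi]\alpha_1+\dots+\mathbb Z[\phi]\alpha_J,\qquad \Psi\Big(\sum_jp_j(\phi)\alpha_j\Big)=\sum_jp_j(D)\beta_j\ \ (p_j\in\mathbb Z[x]),\qquad \widetilde L=\{(x,\Psi(x)):x\in L\},$$ and $\Lambda(V)=\{x\in L:\Psi(x)\in V\}$ for $V\subset\mathbb G$. Assume that $\mathcal T$ is rigid, i.e. there is a linear isomorphism $\sigma$ of $\mathbb R^d$ (onto these coordinates) that intertwines $\phi$ with its block form and satisfies $\sigma(\mathcal C_i)\subset L$ for all $i$; identify $\mathcal C$ with $\sigma(\mathcal C)$. Assume also that the control points are normalized so that the group generated by $\Xi$ is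 $L$, and that $(\mathbb R^d\times\mathbb G,\widetilde L)$ is a cut-and-project scheme: $\widetilde L$ is discrete and cocompact, the projection to $\mathbb R^d$ is injective on $\widetilde L$, and the projection of $\widetilde L$ to $\mathbb G$ is dense. **Proposition.** Suppose that for some $N\ge1$ and some $j$ with $0\in\mathcal C_j$, $$\mathcal C=\lim_{n\to\infty}(\Phi^N)^n(\{0\})\qquad\text{and}\qquad\phi^N\,\Xi\subset\mathcal C_j,$$ where $\{0\}$ is the $\kappa$-set consisting of the single point $0$ of colour $j$, and the limit means that, for every $i$, each point belongs to the $i$-th component of $(\Phi^N)^n(\{0\})$ for all large $n$ if it is in $\mathcal C_i$ and for no large $n$ otherwise. Then for every $i\le\kappa$ there is a largest open set $U_i\subset\mathbb G$ with $\mathcal C_i=\Lambda(U_i)$; it has nonempty interior and compact closure (so $\mathcal C_i$ is a Euclidean model set), and its boundary $\partial U_i=\overline{U_i}\setminus U_i$ has Haar (Lebesgue) measure zero. -/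

import Mathlib

namespace SubstTiling

/-- The Euclidean space `ℝ^d`. -/
abbrev Rd (d : ℕ) : Type := EuclideanSpace ℝ (Fin d)

/-! ### Tiles, tilings and tile-substitutions -/

/-- A tile in `ℝ^d` with one of `κ` colours: a nonempty compact set which is the closure of its
interior, together with its colour. -/
@[ext] structure Tile (d κ : ℕ) where
  supp : Set (Rd d)
  color : Fin κ
  nonempty : supp.Nonempty
  isCompact : IsCompact supp
  closure_interior : closure (interior supp) = supp

/-- The translate `g + T = (g + A, i)` of a tile `T = (A, i)`. -/
instance (d κ : ℕ) : VAdd (Rd d) (Tile d κ) where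
  vadd g T :=
    { supp := (fun x => g + x) '' T.supp
      color := T.color
      nonempty := T.nonempty.image _
      isCompact := T.isCompact.image (continuous_const.add continuous_id)
      closure_interior := by
        have h := T.closure_interior
        have h1 : (fun x => g + x) = ⇑(Homeomorph.addLeft g) := rfl
        rw [h1, ← Homeomorph.image_interior, ← Homeomorph.image_closure, h] }

/-- A tiling of `ℝ^d`: the tiles cover the space, distinct tiles have disjoint interiors, and tiles
of the same colour are translationally equivalent. -/
structure IsTiling {d κ : ℕ} (𝒯 : Set (Tile d κ)) : Prop where
  cover : (⋃ T ∈ 𝒯, T.supp) = Set.univ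
  disjoint : ∀ T ∈ 𝒯, ∀ T' ∈ 𝒯, T ≠ T' → Disjoint (interior T.supp) (interior T'.supp)
  translate : ∀ T ∈ 𝒯, ∀ T' ∈ 𝒯, T.color = T'.color → ∃ g : Rd d, T' = g +ᵥ T

/-- Repetitivity: the translates of every finite patch occurring in `𝒯` are relatively dense. -/
def IsRepetitive {d κ : ℕ} (𝒯 : Set (Tile d κ)) : Prop :=
  ∀ P : Set (Tile d κ), P.Finite → P ⊆ 𝒯 →
    ∃ R : ℝ, ∀ x : Rd d, ∃ g : Rd d, dist g x ≤ R ∧ ∀ T ∈ P, g +ᵥ T ∈ 𝒯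

/-- `φ` is expansive: it expands distances by a factor `c > 1` for some metric that induces the
standard topology. -/
def IsExpansive {d : ℕ} (φ : Module.End ℝ (Rd d)) : Prop :=
  ∃ M : MetricSpace (Rd d),
    M.toPseudoMetricSpace.toUniformSpace.toTopologicalSpace =
        (inferInstance : TopologicalSpace (Rd d)) ∧
      ∃ c : ℝ, 1 < c ∧ ∀ x y : Rd d, c * M.dist x y ≤ M.dist (φ x) (φ y)

/-- A tile-substitution with linear map `φ`: prototiles `T_i = (A_i, i)` and finite digit sets
`D_{ij}` with `φ A_j = ⋃_i (D_{ij} + A_i)`, where the sets on the right have disjoint interiors. -/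
structure TileSubstitution {d : ℕ} (κ : ℕ) (φ : Module.End ℝ (Rd d)) where
  proto : Fin κ → Tile d κ
  color_proto : ∀ i, (proto i).color = i
  digits : Fin κ → Fin κ → Finset (Rd d)
  subdivision : ∀ j, φ '' (proto j).supp = ⋃ i, ⋃ u ∈ digits i j, (u +ᵥ proto i).supp
  disjoint : ∀ j i i' : Fin κ, ∀ u ∈ digits i j, ∀ u' ∈ digits i' j, (i, u) ≠ (i', u') →
    Disjoint (interior (u +ᵥ proto i).supp) (interior (u' +ᵥ proto i').supp)

namespace TileSubstitution

variable {d κ : ℕ} {φ : Module.End ℝ (Rd d)} (ω : TileSubstitution κ φ)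

/-- The substitution matrix `S(i,j) = # D_{ij}`. -/
def substMatrix : Matrix (Fin κ) (Fin κ) ℕ :=
  Matrix.of fun i j => (ω.digits i j).card

/-- Primitivity: some positive power of the substitution matrix has no zero entry. -/
def IsPrimitive : Prop :=
  ∃ l : ℕ, 0 < l ∧ ∀ i j, 0 < (ω.substMatrix ^ l) i j

/-- The patch `ω(T)`; explicitly `ω(x + T_j) = {φ x + u + T_i : u ∈ D_{ij}, i ≤ κ}`. -/
def onTile (T : Tile d κ) : Set (Tile d κ) :=
  {T' | ∃ (x : Rd d) (j i : Fin κ), T = x +ᵥ ω.proto j ∧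
    ∃ u ∈ ω.digits i j, T' = (φ x + u) +ᵥ ω.proto i}

/-- `𝒯` is a substitution tiling: a tiling by translates of the prototiles with `ω(𝒯) = 𝒯`. -/
structure IsSubstitutionTiling (𝒯 : Set (Tile d κ)) : Prop where
  isTiling : IsTiling 𝒯
  translate_proto : ∀ T ∈ 𝒯, ∃ x : Rd d, T = x +ᵥ ω.proto T.color
  fixed : (⋃ T ∈ 𝒯, ω.onTile T) = 𝒯

/-- A tile map: `γ T` is a tile of the patch `ω(T)`, chosen with the same relative position for all
tiles of the same type. -/
structure IsTileMap (𝒯 : Set (Tile d κ)) (γ : Tile d κ → Tile d κ) : Prop where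
  mem : ∀ T ∈ 𝒯, γ T ∈ ω.onTile T
  relative : ∀ T ∈ 𝒯, ∀ g : Rd d, g +ᵥ T ∈ 𝒯 → γ (g +ᵥ T) = φ g +ᵥ γ T

end TileSubstitution

/-! ### Control points and the associated `κ`-set substitution -/

/-- `c T` is the control point of `T`, i.e. `{c T} = ⋂_{m ≥ 0} φ^{-m} (γ^m T)`. -/
def IsControlPointMap {d κ : ℕ} (φ : Module.End ℝ (Rd d)) (𝒯 : Set (Tile d κ))
    (γ : Tile d κ → Tile d κ) (c : Tile d κ → Rd d) : Prop :=
  ∀ T ∈ 𝒯, {c T} = ⋂ m : ℕ, ⇑(φ ^ m) ⁻¹' (γ^[m] T).supp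

/-- The set `C_i` of control points of the tiles of colour `i`. -/
def controlPoints {d κ : ℕ} (𝒯 : Set (Tile d κ)) (c : Tile d κ → Rd d) (i : Fin κ) :
    Set (Rd d) :=
  c '' {T ∈ 𝒯 | T.color = i}

/-- `Ξ = ⋃_i (C_i - C_i)`. -/
def differences {d κ : ℕ} (C : Fin κ → Set (Rd d)) : Set (Rd d) :=
  {z | ∃ i, ∃ x ∈ C i, ∃ y ∈ C i, z = x - y}

/-- The digit sets of the control points, for which `C_i = ⋃_j (φ C_j + D_{ij})`: the vectors
`c(T') - φ c(T)` with `T` a tile of colour `j` and `T'` a tile of colour `i` in `ω(T)`. (These are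
the digit sets of `ω` itself when every prototile has its control point at the origin.) -/
def controlDigits {d κ : ℕ} {φ : Module.End ℝ (Rd d)} (ω : TileSubstitution κ φ)
    (𝒯 : Set (Tile d κ)) (c : Tile d κ → Rd d) (i j : Fin κ) : Set (Rd d) :=
  {a | ∃ T ∈ 𝒯, T.color = j ∧ ∃ T' ∈ ω.onTile T, T'.color = i ∧ a = c T' - φ (c T)}

/-- The `κ`-set substitution `Φ`, with `Φ_{ij} = {x ↦ φ x + a : a ∈ D_{ij}}` and
`Φ(X)_i = ⋃_j Φ_{ij}(X_j)`. -/
def kSetSubst {d κ : ℕ} (φ : Module.End ℝ (Rd d)) (D : Fin κ → Fin κ → Set (Rd d))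
    (X : Fin κ → Set (Rd d)) : Fin κ → Set (Rd d) :=
  fun i => {y | ∃ j, ∃ a ∈ D i j, ∃ x ∈ X j, y = φ x + a}

/-- The `κ`-set whose only point is the origin, with colour `j`. -/
def originKSet {d κ : ℕ} (j : Fin κ) : Fin κ → Set (Rd d) :=
  fun i => {x | i = j ∧ x = 0}

/-- `C = lim_n X_n` as `κ`-sets: every point of every colour lies in `X_n` for all large `n` or
outside `X_n` for all large `n`, according as it lies in `C` or not. -/
def IsKSetLimit {d κ : ℕ} (X : ℕ → Fin κ → Set (Rd d)) (C : Fin κ → Set (Rd d)) : Prop :=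
  ∀ i x, ∀ᶠ n in Filter.atTop, (x ∈ X n i ↔ x ∈ C i)

/-! ### The expansion map -/

/-- The set of (complex) eigenvalues of `φ`. -/
noncomputable def eigs {d : ℕ} (φ : Module.End ℝ (Rd d)) : Finset ℂ :=
  (φ.charpoly.aroots ℂ).toFinset

/-- `φ` is diagonalizable over `ℂ`: its complexification has a basis of eigenvectors. -/
def IsDiagonalizable {d : ℕ} (φ : Module.End ℝ (Rd d)) : Prop :=
  ∃ b : Module.Basis (Fin d) ℂ (TensorProduct ℝ ℂ (Rd d)),
    ∀ i, ∃ z : ℂ, LinearMap.baseChange ℂ φ (b i) = z • b i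

/-- All eigenvalues of `φ` are algebraic integers, they are algebraically conjugate, and each has
multiplicity `J`. -/
structure HasConjugateEigenvalues {d : ℕ} (φ : Module.End ℝ (Rd d)) (J : ℕ) : Prop where
  integral : ∀ z ∈ eigs φ, IsIntegral ℤ z
  conj : ∀ z ∈ eigs φ, ∀ w ∈ eigs φ, IsConjRoot ℚ z w
  mult : ∀ z ∈ eigs φ, (φ.charpoly.aroots ℂ).count z = J

/-- `φ` is unimodular: its minimal polynomial over `ℚ` has constant term `±1`. -/
def IsUnimodular {d : ℕ} (φ : Module.End ℝ (Rd d)) : Prop :=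
  (minpoly ℚ φ).coeff 0 = 1 ∨ (minpoly ℚ φ).coeff 0 = -1

/-- The roots of the minimal polynomial of `φ` over `ℚ` that are not eigenvalues of `φ`. -/
noncomputable def otherConjugates {d : ℕ} (φ : Module.End ℝ (Rd d)) : Finset ℂ :=
  ((minpoly ℚ φ).aroots ℂ).toFinset \ eigs φ

/-! ### Block matrices and the cut-and-project scheme -/

/-- For a finite set `S` of complex numbers closed under conjugation, the real block diagonal matrix
with a `1 × 1` block `z` for each real `z ∈ S` and a block `!![a, -b; b, a]` for each pair
`z = a + i b`, `conj z` in `S`: its coordinates are indexed by `S`, and the block of a nonreal pair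
occupies the coordinates `z`, `conj z` (with `b > 0`). -/
noncomputable def rootBlock (S : Finset ℂ) : Matrix S S ℝ :=
  Matrix.of fun z w =>
    (if (w : ℂ) = z then (z : ℂ).re else 0) -
      (if (w : ℂ) = (starRingEnd ℂ) (z : ℂ) then (z : ℂ).im else 0)

/-- The block diagonal matrix with `J` copies of `rootBlock S`. -/
noncomputable def rootMatrix (S : Finset ℂ) (J : ℕ) : Matrix (S × Fin J) (S × Fin J) ℝ :=
  Matrix.blockDiagonal fun _ : Fin J => rootBlock S

/-- The vector with all coordinates `1` in the `j`-th block and `0` in the other blocks. -/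
def blockOnes (S : Finset ℂ) (J : ℕ) (j : Fin J) : S × Fin J → ℝ :=
  fun a => if a.2 = j then 1 else 0

/-- The additive map `(p_1, …, p_J) ↦ ∑_j p_j(B) e_j` on integer polynomials, where `B` is
`rootMatrix S J` and `e_j` is `blockOnes S J j`. -/
noncomputable def polyMap (S : Finset ℂ) (J : ℕ) :
    (Fin J → Polynomial ℤ) →+ (S × Fin J → ℝ) where
  toFun p := ∑ j, (Polynomial.aeval (rootMatrix S J) (p j)).mulVec (blockOnes S J j)
  map_zero' := by simp
  map_add' p q := by simp [Matrix.add_mulVec, Finset.sum_add_distrib]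

/-- The physical space `ℝ^d`, in the coordinates in which `φ` is the block diagonal matrix
`rootMatrix (eigs φ) J`. -/
abbrev Physical {d : ℕ} (φ : Module.End ℝ (Rd d)) (J : ℕ) : Type := eigs φ × Fin J → ℝ

/-- The Euclidean internal space `𝔾 = 𝔾_1 × ⋯ × 𝔾_J`, on which `D = rootMatrix (otherConjugates φ) J`
acts. -/
abbrev Internal {d : ℕ} (φ : Module.End ℝ (Rd d)) (J : ℕ) : Type := otherConjugates φ × Fin J → ℝ

/-- `L = ℤ[φ] α_1 + ⋯ + ℤ[φ] α_J`. -/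
noncomputable def physicalModule {d : ℕ} (φ : Module.End ℝ (Rd d)) (J : ℕ) :
    AddSubgroup (Physical φ J) :=
  (polyMap (eigs φ) J).range

/-- The lifted module `{(x, Ψ(x)) : x ∈ L}` in `ℝ^d × 𝔾`, where
`Ψ(∑_j p_j(φ) α_j) = ∑_j p_j(D) β_j`. -/
noncomputable def liftedModule {d : ℕ} (φ : Module.End ℝ (Rd d)) (J : ℕ) :
    AddSubgroup (Physical φ J × Internal φ J) :=
  ((polyMap (eigs φ) J).prod (polyMap (otherConjugates φ) J)).range

/-- `(X, H, L)` is a cut-and-project scheme: `L` is a lattice (discrete and cocompact) in `X × H`,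
the first projection is injective on `L`, and the second projection of `L` is dense in `H`. -/
structure IsCutAndProjectScheme {X H : Type} [AddCommGroup X] [TopologicalSpace X]
    [AddCommGroup H] [TopologicalSpace H] (L : AddSubgroup (X × H)) : Prop where
  discrete : DiscreteTopology L
  cocompact : CompactSpace ((X × H) ⧸ L)
  injOn : Set.InjOn Prod.fst (L : Set (X × H))
  dense : Dense (Prod.snd '' (L : Set (X × H)))

/-- `Λ(V) = {π₁(x) : x ∈ L, π₂(x) ∈ V}`. -/
def modelSet {X H : Type} [AddCommGroup X] [AddCommGroup H] (L : AddSubgroup (X × H))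
    (V : Set H) : Set X :=
  Prod.fst '' {x : X × H | x ∈ L ∧ x.2 ∈ V}

/-- `σ` exhibits rigidity of the control points `C`: a linear isomorphism that carries `φ` to its
block diagonal form and every `C_i` into `L = ℤ[φ] α_1 + ⋯ + ℤ[φ] α_J`. -/
structure IsRigidifying {d κ : ℕ} (φ : Module.End ℝ (Rd d)) (J : ℕ) (C : Fin κ → Set (Rd d))
    (σ : Rd d ≃ₗ[ℝ] Physical φ J) : Prop where
  conj : ∀ x, σ (φ x) = (rootMatrix (eigs φ) J).mulVec (σ x)
  subset : ∀ i, σ '' C i ⊆ physicalModule φ J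

end SubstTiling

/-!
The control points are lifted to the lattice `L̃ ⊂ ℝ^d × 𝔾`, on which `A = φ × D` acts bijectively
because `φ` is unimodular. `LiftedKSet` collects what is known about the lifted sets `X_i`, and the
proof takes place there. Write `Ψ(z)` for the internal part of `z`, and `Ξ` for the lifted
differences.

*Bounded windows* (`LiftedKSet.exists_bound_base`). The inclusion `φ^N Ξ ⊂ C_j` makes `Ξ ± Ξ`
locally finite, so `Ψ` is additive up to a bounded error on the relatively dense set `X_j`. By
Hyers' theorem it stays at bounded distance from a linear map `l`, and `l` intertwines `φ` and `D`.
These have no common eigenvalue, so `l = 0` and `Ψ(X_j)` is bounded.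

*Contraction* (`LiftedKSet.tendsto_iterate`). As `A^N (Ξ + Ξ) ⊂ Ξ`, the points `2^k A^(Nk) z` with
`z ∈ Ξ` have bounded internal part; the internal parts of `Ξ` span `𝔾`, so `D^n → 0`.

*Open windows* (`LiftedKSet.exists_nhd`). The sets `A^(-Nn) Ξ` exhaust the lattice. The lattice
points with internal part in a ball differ from points of `X_j` by finitely many lattice vectors, so
a single power of `A` takes all of them into `X_j`; hence `X_j` contains all lattice points over a
neighbourhood of `0`. A point `x` of `X_i` is the image of `0` under a composition `z ↦ A^n z + x`
of maps of the substitution, which carries this neighbourhood to one of `Ψ(x)`.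

*Null boundary* (`LiftedKSet.measure_frontier_window`). The boundary of `U_i` is covered by the
pieces `D ∂U_k + Ψ(a)`, where `a` runs through the digits. The volumes of the interiors of the
prototiles form a subinvariant weight of the substitution matrix, and `|det D| |det φ| = 1`; so the
pieces cover the boundary exactly, in measure, and each of them lies in it up to a null set. But
some `D^n` is among the compositions from colour `j` to itself and takes the closure of `U_j` into
`U_j`, so `∂U_j` is null, and primitivity gives the same for all colours.
-/

section

open Filter Topology MeasureTheory Polynomial

/-! ### Quasi-additive maps -/

/-- An additive map that is bounded on the unit ball is continuous. -/
theorem AddMonoidHom.continuous_of_bounded_unitBall {E G : Type*}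
    [NormedAddCommGroup E] [NormedSpace ℝ E] [NormedAddCommGroup G] [NormedSpace ℝ G]
    (l : E →+ G) (M : ℝ) (hM : ∀ v : E, ‖v‖ ≤ 1 → ‖l v‖ ≤ M) : Continuous l := by
  refine continuous_of_continuousAt_zero l ?_
  rw [Metric.continuousAt_iff]
  intro ε hε
  obtain ⟨n, hn⟩ := exists_nat_gt (M / ε)
  have hM0 : 0 ≤ M := le_trans (norm_nonneg _) (hM 0 (by simp))
  have hn0 : (0 : ℝ) < n := lt_of_le_of_lt (by positivity) hn
  refine ⟨1 / n, by positivity, fun {v} hv => ?_⟩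
  rw [dist_zero_right] at hv
  have h1 : ‖n • v‖ ≤ 1 := by
    rw [← Nat.cast_smul_eq_nsmul ℝ, norm_smul, Real.norm_natCast]
    rw [lt_div_iff₀ hn0] at hv
    linarith
  have h2 := hM _ h1
  rw [map_nsmul, ← Nat.cast_smul_eq_nsmul ℝ, norm_smul, Real.norm_natCast] at h2
  rw [div_lt_iff₀ hε] at hn
  rw [map_zero, dist_zero_right]
  by_contra! h3
  nlinarith

/-- Hyers' theorem: a map that is additive up to a bounded error and bounded on the unit ball is at
bounded distance from a continuous linear map, the limit of `2⁻ⁿ f (2ⁿ v)`. -/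
theorem exists_continuousLinearMap_norm_sub_le {E G : Type*}
    [NormedAddCommGroup E] [NormedSpace ℝ E] [NormedAddCommGroup G] [NormedSpace ℝ G]
    [CompleteSpace G] (f : E → G) (M : ℝ) (hf : ∀ u v, ‖f (u + v) - f u - f v‖ ≤ M)
    (hb : ∀ v, ‖v‖ ≤ 1 → ‖f v‖ ≤ M) :
    ∃ l : E →L[ℝ] G, ∀ v, ‖f v - l v‖ ≤ M := by
  set g : ℕ → E → G := fun n v => (1 / 2 : ℝ) ^ n • f ((2 : ℝ) ^ n • v) with hg
  have hstep : ∀ v n, dist (g n v) (g (n + 1) v) ≤ M / 2 * (1 / 2) ^ n := by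
    intro v n
    have h1 := hf ((2 : ℝ) ^ n • v) ((2 : ℝ) ^ n • v)
    have h2 : (2 : ℝ) ^ n • v + (2 : ℝ) ^ n • v = (2 : ℝ) ^ (n + 1) • v := by
      rw [← two_smul ℝ, smul_smul, pow_succ']
    rw [h2] at h1
    have h3 : g (n + 1) v - g n v = (1 / 2 : ℝ) ^ (n + 1) •
        (f ((2 : ℝ) ^ (n + 1) • v) - f ((2 : ℝ) ^ n • v) - f ((2 : ℝ) ^ n • v)) := by
      simp only [hg, pow_succ]
      module
    rw [dist_comm, dist_eq_norm, h3, norm_smul, norm_pow, Real.norm_of_nonneg (by norm_num)]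
    rw [pow_succ]
    nlinarith [pow_pos (show (0 : ℝ) < 1 / 2 by norm_num) n]
  have hcau : ∀ v, CauchySeq fun n => g n v := fun v =>
    cauchySeq_of_le_geometric (1 / 2) (M / 2) (by norm_num) (hstep v)
  choose l hl using fun v => cauchySeq_tendsto_of_complete (hcau v)
  have hdist : ∀ v, ‖f v - l v‖ ≤ M := by
    intro v
    have := dist_le_of_le_geometric_of_tendsto₀ (1 / 2) (M / 2) (by norm_num) (hstep v) (hl v)
    rw [dist_eq_norm] at this
    simp only [hg, pow_zero, one_smul] at this
    exact this.trans_eq (by ring)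
  have hadd : ∀ u v, l (u + v) = l u + l v := by
    intro u v
    have h1 : Filter.Tendsto (fun n => g n (u + v) - g n u - g n v) Filter.atTop
        (nhds (l (u + v) - l u - l v)) := ((hl _).sub (hl _)).sub (hl _)
    have h2 : Filter.Tendsto (fun n => g n (u + v) - g n u - g n v) Filter.atTop (nhds 0) := by
      refine squeeze_zero_norm (a := fun n => (1 / 2 : ℝ) ^ n * M) (fun n => ?_) ?_
      · have h3 : g n (u + v) - g n u - g n v = (1 / 2 : ℝ) ^ n •
            (f ((2 : ℝ) ^ n • u + (2 : ℝ) ^ n • v) - f ((2 : ℝ) ^ n • u)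
              - f ((2 : ℝ) ^ n • v)) := by
          simp only [hg, smul_add]
          module
        rw [h3, norm_smul, norm_pow, Real.norm_of_nonneg (by norm_num)]
        exact mul_le_mul_of_nonneg_left (hf _ _) (by positivity)
      · simpa using (tendsto_pow_atTop_nhds_zero_of_lt_one (r := (1 / 2 : ℝ)) (by norm_num)
          (by norm_num)).mul_const M
    have h4 := tendsto_nhds_unique h1 h2
    rw [sub_sub, sub_eq_zero] at h4
    exact h4
  let l' : E →+ G := AddMonoidHom.mk' l hadd
  have hcont : Continuous l' := by
    refine l'.continuous_of_bounded_unitBall (M + M) fun v hv => ?_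
    have h1 : l' v = f v - (f v - l v) := by simp [l']
    rw [h1]
    exact (norm_sub_le _ _).trans (add_le_add (hb v hv) (hdist v))
  exact ⟨l'.toRealLinearMap hcont, hdist⟩

/-- A linear map that is bounded on a relatively dense set vanishes. -/
theorem ContinuousLinearMap.eq_zero_of_bounded_on_relDense {E G : Type*}
    [NormedAddCommGroup E] [NormedSpace ℝ E] [NormedAddCommGroup G] [NormedSpace ℝ G]
    (l : E →L[ℝ] G) (R M : ℝ) (h : ∀ v : E, ∃ x : E, ‖x - v‖ ≤ R ∧ ‖l x‖ ≤ M) : l = 0 := by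
  ext v
  have hb : ∀ u : E, ‖l u‖ ≤ M + ‖l‖ * R := by
    intro u
    obtain ⟨x, hx, hx'⟩ := h u
    have h1 : l u = l x - l (x - u) := by simp
    rw [h1]
    refine (norm_sub_le _ _).trans (add_le_add hx' ?_)
    exact (l.le_opNorm _).trans (mul_le_mul_of_nonneg_left hx (norm_nonneg _))
  by_contra hne
  have hpos : 0 < ‖l v‖ := norm_pos_iff.2 hne
  obtain ⟨n, hn⟩ := exists_nat_gt ((M + ‖l‖ * R) / ‖l v‖)
  have h2 := hb (n • v)
  rw [map_nsmul, ← Nat.cast_smul_eq_nsmul ℝ, norm_smul, Real.norm_natCast] at h2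
  rw [div_lt_iff₀ hpos] at hn
  linarith

/-! ### Substitution systems in a cut-and-project scheme -/

/-- Compositions of `n` of the maps `z ↦ A z + a`, `a ∈ digits i k`: `DigitReach A digits n i k a`
says that some such composition takes colour `k` to colour `i` and equals `z ↦ Aⁿ z + a`. -/
inductive DigitReach {V κ : Type*} [AddCommGroup V] (A : V → V) (digits : κ → κ → Set V) :
    ℕ → κ → κ → V → Prop
  | refl (i : κ) : DigitReach A digits 0 i i 0
  | step {n : ℕ} {i k l : κ} {a b : V} : a ∈ digits i k → DigitReach A digits n k l b →
      DigitReach A digits (n + 1) i l (A b + a)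

/-- A `κ`-set `X` in a lattice of `E × G` that is fixed by a substitution with linear part `B × D`,
together with the properties from which `X` is recognized as a model set. `base` is the colour `j`
of the coincidence and `period` its exponent `N`. The fields `relDense` and `locFinite` concern the
physical parts of `X base`, and `spectrum` says that `B` and `D` have no common eigenvalue: some
polynomial annihilates `B` and is injective at `D`. `reach_base` says that every point of `X`
lies in arbitrarily late iterates of the substitution, started at the origin with colour `base`. -/
structure LiftedKSet (E G κ : Type*) [NormedAddCommGroup E] [NormedSpace ℝ E]
    [NormedAddCommGroup G] [NormedSpace ℝ G] where
  lattice : AddSubgroup (E × G)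
  B : E ≃L[ℝ] E
  D : G ≃L[ℝ] G
  X : κ → Set (E × G)
  digits : κ → κ → Finset (E × G)
  base : κ
  period : ℕ
  period_pos : 0 < period
  finite_inter : ∀ R : ℝ, {z : E × G | z ∈ lattice ∧ ‖z‖ ≤ R}.Finite
  dense : Dense (Prod.snd '' (lattice : Set (E × G)))
  map_mem_iff : ∀ z, B.prodCongr D z ∈ lattice ↔ z ∈ lattice
  mem_lattice : ∀ i, ∀ z ∈ X i, z ∈ lattice
  mem_iff : ∀ i x, x ∈ X i ↔ ∃ k, ∃ a ∈ digits i k, ∃ y ∈ X k, x = B.prodCongr D y + a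
  exists_digit : ∀ k, ∃ i, (digits i k).Nonempty
  zero_mem : 0 ∈ X base
  coincidence : ∀ i, ∀ x ∈ X i, ∀ y ∈ X i, (B.prodCongr D)^[period] (x - y) ∈ X base
  reach_base : ∀ i, ∀ x ∈ X i, ∀ m : ℕ, ∃ n ≥ m,
    DigitReach (B.prodCongr D) (fun i k => digits i k) n i base x
  exists_reach : ∀ i k, ∃ n a, DigitReach (B.prodCongr D) (fun i k => digits i k) n i k a
  closure_diff : AddSubgroup.closure {z | ∃ i, ∃ x ∈ X i, ∃ y ∈ X i, z = x - y} = lattice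
  relDense : ∃ R : ℝ, ∀ v : E, ∃ x ∈ X base, ‖x.1 - v‖ ≤ R
  locFinite : ∀ R : ℝ, {x | x ∈ X base ∧ ‖x.1‖ ≤ R}.Finite
  spectrum : ∃ q : Polynomial ℝ, Polynomial.aeval (B : E →ₗ[ℝ] E) q = 0 ∧
    Function.Injective (Polynomial.aeval (D : G →ₗ[ℝ] G) q)

namespace LiftedKSet

variable {E G κ : Type*} [NormedAddCommGroup E] [NormedSpace ℝ E]
  [NormedAddCommGroup G] [NormedSpace ℝ G] (S : LiftedKSet E G κ)

/-- The linear part `B × D` of the substitution. -/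
def A : (E × G) ≃L[ℝ] (E × G) := S.B.prodCongr S.D

/-- The differences of points of equal colour. -/
def diff : Set (E × G) := {z | ∃ i, ∃ x ∈ S.X i, ∃ y ∈ S.X i, z = x - y}

/-- The composition `z ↦ Aⁿ z + a` of maps of the substitution takes colour `k` to colour `i`. -/
def Reach : ℕ → κ → κ → E × G → Prop := DigitReach S.A (fun i k => S.digits i k)

theorem A_iterate (n : ℕ) (z : E × G) : S.A^[n] z = (S.B^[n] z.1, S.D^[n] z.2) := by
  induction n generalizing z with
  | zero => rfl
  | succ n ih => rw [Function.iterate_succ_apply, ih]; rfl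

theorem map_iterate_mem_iff (n : ℕ) (z : E × G) : S.A^[n] z ∈ S.lattice ↔ z ∈ S.lattice := by
  induction n generalizing z with
  | zero => rfl
  | succ n ih => rw [Function.iterate_succ_apply, ih]; exact S.map_mem_iff z

theorem map_add_digit_mem {i k : κ} {a y : E × G} (ha : a ∈ S.digits i k) (hy : y ∈ S.X k) :
    S.A y + a ∈ S.X i :=
  (S.mem_iff _ _).2 ⟨k, a, ha, y, hy, rfl⟩

theorem Reach.mem {n : ℕ} {i k : κ} {a : E × G} (h : S.Reach n i k a) :
    ∀ y ∈ S.X k, S.A^[n] y + a ∈ S.X i := by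
  induction h with
  | refl i => intro y hy; simpa using hy
  | step ha _ ih =>
    intro y hy
    have h1 := S.map_add_digit_mem ha (ih y hy)
    rw [Function.iterate_succ_apply']
    rwa [map_add, add_assoc] at h1

theorem X_nonempty (i : κ) : (S.X i).Nonempty := by
  obtain ⟨n, a, h⟩ := S.exists_reach i S.base
  exact ⟨_, Reach.mem S h 0 S.zero_mem⟩

theorem sub_mem_diff {i : κ} {x y : E × G} (hx : x ∈ S.X i) (hy : y ∈ S.X i) :
    x - y ∈ S.diff := ⟨i, x, hx, y, hy, rfl⟩

theorem mem_diff_of_mem_base {x : E × G} (hx : x ∈ S.X S.base) : x ∈ S.diff := by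
  simpa using S.sub_mem_diff hx S.zero_mem

theorem zero_mem_diff : (0 : E × G) ∈ S.diff := S.mem_diff_of_mem_base S.zero_mem

theorem neg_mem_diff {z : E × G} (hz : z ∈ S.diff) : -z ∈ S.diff := by
  obtain ⟨i, x, hx, y, hy, rfl⟩ := hz
  exact ⟨i, y, hy, x, hx, by simp⟩

theorem map_mem_diff {z : E × G} (hz : z ∈ S.diff) : S.A z ∈ S.diff := by
  obtain ⟨k, x, hx, y, hy, rfl⟩ := hz
  obtain ⟨i, a, ha⟩ := S.exists_digit k
  have := S.sub_mem_diff (S.map_add_digit_mem ha hx) (S.map_add_digit_mem ha hy)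
  simpa using this

theorem iterate_mem_diff (n : ℕ) {z : E × G} (hz : z ∈ S.diff) : S.A^[n] z ∈ S.diff := by
  induction n with
  | zero => exact hz
  | succ n ih => rw [Function.iterate_succ_apply']; exact S.map_mem_diff ih

theorem iterate_period_mem_base {z : E × G} (hz : z ∈ S.diff) :
    S.A^[S.period] z ∈ S.X S.base := by
  obtain ⟨k, x, hx, y, hy, rfl⟩ := hz
  exact S.coincidence k x hx y hy

theorem iterate_mem_base {n : ℕ} (hn : S.period ≤ n) {z : E × G} (hz : z ∈ S.diff) :
    S.A^[n] z ∈ S.X S.base := by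
  obtain ⟨m, rfl⟩ := Nat.exists_eq_add_of_le hn
  rw [Function.iterate_add_apply]
  exact S.iterate_period_mem_base (S.iterate_mem_diff m hz)

/-- The coincidence property makes the differences closed under addition, up to a power of `A`. -/
theorem iterate_period_add_mem_diff {x y : E × G} (hx : x ∈ S.diff) (hy : y ∈ S.diff) :
    S.A^[S.period] (x + y) ∈ S.diff := by
  rw [iterate_map_add]
  have := S.sub_mem_diff (S.iterate_period_mem_base hx)
    (S.iterate_period_mem_base (S.neg_mem_diff hy))
  simpa [iterate_map_neg] using this

theorem exists_norm_iterate_le (f : E ≃L[ℝ] E) (n : ℕ) (R : ℝ) :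
    ∃ M, ∀ v : E, ‖v‖ ≤ R → ‖f^[n] v‖ ≤ M := by
  refine ⟨‖(f : E →L[ℝ] E) ^ n‖ * R, fun v hv => ?_⟩
  have h : f^[n] v = ((f : E →L[ℝ] E) ^ n) v := by
    rw [FunLike.coe_pow_eq_iterate]; rfl
  rw [h]
  exact (ContinuousLinearMap.le_opNorm _ _).trans (by gcongr)

/-- The Meyer property: sums of two differences with bounded physical part have bounded internal
part. -/
theorem exists_bound_add (R : ℝ) :
    ∃ M : ℝ, ∀ x ∈ S.diff, ∀ y ∈ S.diff, ‖(x + y).1‖ ≤ R → ‖(x + y).2‖ ≤ M := by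
  obtain ⟨R', hR'⟩ := exists_norm_iterate_le S.B (S.period + S.period) R
  have hinj : Function.Injective (S.A^[S.period + S.period]) := S.A.injective.iterate _
  have hfin := ((S.locFinite R').preimage hinj.injOn).image fun z => ‖z.2‖
  obtain ⟨M, hM⟩ := hfin.bddAbove
  refine ⟨M, fun x hx y hy hxy => hM ⟨x + y, ⟨?_, ?_⟩, rfl⟩⟩
  · rw [Function.iterate_add_apply]
    exact S.iterate_period_mem_base (S.iterate_period_add_mem_diff hx hy)
  · rw [A_iterate]
    exact hR' _ hxy

/-- On the points of the base colour the internal part is a linear function of the physical part, up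
to a bounded error. -/
theorem exists_linear_approx [CompleteSpace G] :
    ∃ l : E →L[ℝ] G, ∃ M : ℝ, ∀ x ∈ S.X S.base, ‖x.2 - l x.1‖ ≤ M := by
  obtain ⟨R, hR⟩ := S.relDense
  choose s hs hsR using hR
  have hR0 : 0 ≤ R := (norm_nonneg _).trans (hsR 0)
  have key : ∀ T : ℝ, ∃ M : ℝ, ∀ x ∈ S.X S.base, ∀ y ∈ S.X S.base, ∀ w ∈ S.X S.base,
      ‖(x + y - w).1‖ ≤ T → ‖(x + y - w).2‖ ≤ M := by
    intro T
    obtain ⟨M, hM⟩ := S.exists_bound_add T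
    refine ⟨M, fun x hx y hy w hw h => ?_⟩
    rw [add_sub_assoc] at h ⊢
    exact hM x (S.mem_diff_of_mem_base hx) (y - w) (S.sub_mem_diff hy hw) h
  have hs1 : ∀ v, ∃ e : E, (s v).1 = v + e ∧ ‖e‖ ≤ R := fun v => ⟨(s v).1 - v, by abel, hsR v⟩
  obtain ⟨M₁, hM₁⟩ := key (3 * R + 1)
  obtain ⟨l, hl⟩ := exists_continuousLinearMap_norm_sub_le (fun v => (s v).2) M₁
    (by
      intro u v
      have h := hM₁ (s u) (hs u) (s v) (hs v) (s (u + v)) (hs _) (by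
        obtain ⟨e₁, h₁, h₁'⟩ := hs1 u
        obtain ⟨e₂, h₂, h₂'⟩ := hs1 v
        obtain ⟨e₃, h₃, h₃'⟩ := hs1 (u + v)
        have : (s u + s v - s (u + v)).1 = e₁ + e₂ - e₃ := by
          simp only [Prod.fst_sub, Prod.fst_add, h₁, h₂, h₃]; abel
        rw [this]
        have := norm_sub_le (e₁ + e₂) e₃
        have := norm_add_le e₁ e₂
        linarith)
      have h2 : (s (u + v)).2 - (s u).2 - (s v).2 = -(s u + s v - s (u + v)).2 := by
        simp only [Prod.snd_sub, Prod.snd_add]; abel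
      rw [h2, norm_neg]
      exact h)
    (by
      intro v hv
      have h := hM₁ (s v) (hs v) 0 S.zero_mem 0 S.zero_mem (by
        obtain ⟨e, h, h'⟩ := hs1 v
        simp only [add_zero, sub_zero, h]
        have := norm_add_le v e
        linarith)
      simpa using h)
  refine ⟨l, M₁ + M₁, fun x hx => ?_⟩
  have h := hM₁ x hx 0 S.zero_mem (s x.1) (hs _) (by
    obtain ⟨e, h, h'⟩ := hs1 x.1
    have : (x + 0 - s x.1).1 = - e := by simp [h]
    rw [this, norm_neg]
    linarith)
  have h2 : x.2 - l x.1 = (x + 0 - s x.1).2 + ((s x.1).2 - l x.1) := by simp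
  rw [h2]
  exact (norm_add_le _ _).trans (add_le_add h (hl _))

/-- The internal parts of the points of the base colour are bounded: the approximating linear map
intertwines `B` and `D`, which have no common eigenvalue. -/
theorem exists_bound_base [CompleteSpace G] : ∃ M : ℝ, ∀ x ∈ S.X S.base, ‖x.2‖ ≤ M := by
  obtain ⟨l, M, hl⟩ := S.exists_linear_approx
  obtain ⟨R, hR⟩ := S.relDense
  set N := S.period with hN
  have hint : (S.D : G →L[ℝ] G) ∘L l ∘L (S.B : E →L[ℝ] E) ^ N =
      l ∘L (S.B : E →L[ℝ] E) ^ (N + 1) := by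
    rw [← sub_eq_zero]
    refine ContinuousLinearMap.eq_zero_of_bounded_on_relDense _ R
      (‖(S.D : G →L[ℝ] G)‖ * M + M) fun v => ?_
    obtain ⟨x, hx, hxv⟩ := hR v
    refine ⟨x.1, hxv, ?_⟩
    have hx' := S.mem_diff_of_mem_base hx
    have h1 := hl _ (S.iterate_mem_base le_rfl hx')
    have h2 := hl _ (S.iterate_mem_base (Nat.le_succ _) hx')
    rw [A_iterate] at h1 h2
    dsimp only at h1 h2
    have hpow : ∀ n, ((S.B : E →L[ℝ] E) ^ n) x.1 = S.B^[n] x.1 := fun n => by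
      rw [FunLike.coe_pow_eq_iterate]; rfl
    have h3 : ((S.D : G →L[ℝ] G) ∘L l ∘L (S.B : E →L[ℝ] E) ^ N -
        l ∘L (S.B : E →L[ℝ] E) ^ (N + 1)) x.1 =
        (S.D^[N + 1] x.2 - l (S.B^[N + 1] x.1)) - S.D (S.D^[N] x.2 - l (S.B^[N] x.1)) := by
      simp only [sub_apply, ContinuousLinearMap.comp_apply, hpow, map_sub,
        Function.iterate_succ_apply' S.D, ContinuousLinearEquiv.coe_coe]
      abel
    rw [h3, add_comm _ M]
    refine (norm_sub_le _ _).trans (add_le_add h2 ?_)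
    exact ((S.D : G →L[ℝ] G).le_opNorm _).trans (mul_le_mul_of_nonneg_left h1 (norm_nonneg _))
  have hint' : ∀ v, S.D (l v) = l (S.B v) := by
    intro v
    have hsurj : Function.Surjective (S.B^[N]) := S.B.surjective.iterate _
    obtain ⟨u, rfl⟩ := hsurj v
    have h := DFunLike.congr_fun hint u
    have hpow : ∀ n, ((S.B : E →L[ℝ] E) ^ n) u = S.B^[n] u := fun n => by
      rw [FunLike.coe_pow_eq_iterate]; rfl
    simpa only [ContinuousLinearMap.comp_apply, hpow, Function.iterate_succ_apply' S.B,
      ContinuousLinearEquiv.coe_coe] using h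
  obtain ⟨q, hqB, hqD⟩ := S.spectrum
  have hpoly : ∀ p : Polynomial ℝ, ∀ v, Polynomial.aeval (S.D : G →ₗ[ℝ] G) p (l v) =
      l (Polynomial.aeval (S.B : E →ₗ[ℝ] E) p v) := by
    intro p
    induction p using Polynomial.induction_on' with
    | add p q hp hq => intro v; simp [hp, hq]
    | monomial n a =>
      intro v
      simp only [Polynomial.aeval_monomial, Module.End.mul_apply, Module.algebraMap_end_apply,
        map_smul]
      congr 1
      induction n generalizing v with
      | zero => simp
      | succ n ih =>
        rw [pow_succ, pow_succ, Module.End.mul_apply, Module.End.mul_apply]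
        rw [← ih]
        congr 1
        exact hint' v
  have hl0 : ∀ v, l v = 0 := by
    intro v
    apply hqD
    rw [hpoly, hqB]
    simp
  exact ⟨M, fun x hx => by simpa [hl0] using hl x hx⟩

theorem exists_bound_diff [CompleteSpace G] : ∃ M : ℝ, ∀ z ∈ S.diff, ‖z.2‖ ≤ M := by
  obtain ⟨M, hM⟩ := S.exists_bound_base
  obtain ⟨M', hM'⟩ := exists_norm_iterate_le S.D.symm S.period M
  refine ⟨M', fun z hz => ?_⟩
  have h := hM' _ (hM _ (S.iterate_period_mem_base hz))
  rw [A_iterate] at h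
  have h2 : Function.LeftInverse S.D.symm^[S.period] S.D^[S.period] :=
    Function.LeftInverse.iterate S.D.symm_apply_apply _
  dsimp only at h
  rwa [h2] at h

theorem exists_bound [CompleteSpace G] (i : κ) : ∃ M : ℝ, ∀ x ∈ S.X i, ‖x.2‖ ≤ M := by
  obtain ⟨M, hM⟩ := S.exists_bound_diff
  obtain ⟨y, hy⟩ := S.X_nonempty i
  refine ⟨M + ‖y.2‖, fun x hx => ?_⟩
  have h1 := hM _ (S.sub_mem_diff hx hy)
  have h2 : x.2 = (x - y).2 + y.2 := by simp
  rw [h2]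
  exact (norm_add_le _ _).trans (by gcongr)

/-! ### Contraction of the internal space -/

theorem lattice_induction {p : E × G → Prop} (hdiff : ∀ z ∈ S.diff, p z)
    (hadd : ∀ x y, p x → p y → p (x + y)) : ∀ z ∈ S.lattice, p z := by
  intro z hz
  rw [← S.closure_diff] at hz
  have hneg : ∀ z ∈ AddSubgroup.closure S.diff, p z ∧ p (-z) := by
    intro z hz
    induction hz using AddSubgroup.closure_induction with
    | mem x hx => exact ⟨hdiff x hx, hdiff _ (S.neg_mem_diff hx)⟩
    | zero => exact ⟨hdiff 0 S.zero_mem_diff, by simpa using hdiff 0 S.zero_mem_diff⟩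
    | add x y _ _ hx hy => exact ⟨hadd _ _ hx.1 hy.1, by rw [neg_add]; exact hadd _ _ hx.2 hy.2⟩
    | neg x _ hx => exact ⟨hx.2, by simpa using hx.1⟩
  exact (hneg z hz).1

/-- For a difference `z` all `2ᵏ A^(Nk) z` are differences, hence have bounded internal part. -/
theorem norm_iterate_mul_two_pow_le {M : ℝ} (hM : ∀ z ∈ S.diff, ‖z.2‖ ≤ M) (k : ℕ) :
    ∀ z ∈ S.diff, ‖S.D^[S.period * k] z.2‖ * 2 ^ k ≤ M := by
  induction k with
  | zero => intro z hz; simpa using hM z hz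
  | succ k ih =>
    intro z hz
    have h := ih _ (S.iterate_period_add_mem_diff hz hz)
    rw [A_iterate] at h
    dsimp only at h
    rw [← Function.iterate_add_apply, ← mul_add_one, Prod.snd_add, iterate_map_add, ← two_smul ℝ,
      norm_smul, Real.norm_of_nonneg (by norm_num)] at h
    rw [pow_succ]
    linarith

theorem tendsto_iterate_of_mem_diff [CompleteSpace G] {z : E × G} (hz : z ∈ S.diff) :
    Tendsto (fun n => S.D^[n] z.2) atTop (𝓝 0) := by
  obtain ⟨M, hM⟩ := S.exists_bound_diff
  have hbound : ∀ n, ‖S.D^[n] z.2‖ ≤ M * (1 / 2) ^ (n / S.period) := by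
    intro n
    have h := S.norm_iterate_mul_two_pow_le hM (n / S.period) _
      (S.iterate_mem_diff (n % S.period) hz)
    rw [A_iterate] at h
    dsimp only at h
    rw [← Function.iterate_add_apply, Nat.div_add_mod] at h
    rw [one_div, inv_pow, ← div_eq_mul_inv, le_div_iff₀ (by positivity)]
    exact h
  refine squeeze_zero_norm hbound ?_
  have h1 : Tendsto (fun n : ℕ => n / S.period) atTop atTop := by
    refine tendsto_atTop_atTop.2 fun b => ⟨b * S.period, fun a ha => ?_⟩
    exact (Nat.le_div_iff_mul_le S.period_pos).2 ha
  have h2 := ((tendsto_pow_atTop_nhds_zero_of_lt_one (r := (1 / 2 : ℝ)) (by norm_num)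
    (by norm_num)).comp h1).const_mul M
  simpa using h2

theorem tendsto_iterate [FiniteDimensional ℝ G] (v : G) :
    Tendsto (fun n => S.D^[n] v) atTop (𝓝 0) := by
  have : CompleteSpace G := FiniteDimensional.complete ℝ G
  have hsmul : ∀ (n : ℕ) (c : ℝ) (v : G), S.D^[n] (c • v) = c • S.D^[n] v := by
    intro n c v
    induction n generalizing v with
    | zero => rfl
    | succ n ih => simp only [Function.iterate_succ_apply, map_smul, ih]
  let W : Submodule ℝ G :=
    { carrier := {v | Tendsto (fun n => S.D^[n] v) atTop (𝓝 0)}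
      add_mem' := fun {a b} ha hb => by
        simp only [Set.mem_ofPred_eq, iterate_map_add] at *
        simpa using ha.add hb
      zero_mem' := by simp [iterate_map_zero]
      smul_mem' := fun c x hx => by
        simp only [Set.mem_ofPred_eq, hsmul] at *
        simpa using hx.const_smul c }
  have hsub : Prod.snd '' (S.lattice : Set (E × G)) ⊆ W := by
    rintro _ ⟨z, hz, rfl⟩
    refine S.lattice_induction (p := fun z => z.2 ∈ W) ?_ ?_ z hz
    · exact fun z hz => S.tendsto_iterate_of_mem_diff hz
    · exact fun x y hx hy => W.add_mem hx hy
  have hclosed : IsClosed (W : Set G) := W.closed_of_finiteDimensional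
  have : v ∈ closure (W : Set G) := (S.dense.mono hsub) v
  rw [hclosed.closure_eq] at this
  exact this

theorem exists_forall_norm_iterate_lt [FiniteDimensional ℝ G] (M : ℝ) {ε : ℝ} (hε : 0 < ε) :
    ∃ n₀, ∀ n ≥ n₀, ∀ v : G, ‖v‖ ≤ M → ‖S.D^[n] v‖ < ε := by
  obtain ⟨C, hC, hbasis⟩ := (Module.finBasis ℝ G).exists_opNorm_le (F := G)
  set δ : ℝ := ε / (C * (|M| + 1)) with hδ
  have hδ0 : 0 < δ := by positivity
  have hev : ∀ᶠ n in atTop, ∀ i, ‖S.D^[n] (Module.finBasis ℝ G i)‖ < δ := by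
    rw [Filter.eventually_all]
    intro i
    have := (S.tendsto_iterate (Module.finBasis ℝ G i)).norm
    rw [norm_zero] at this
    exact this.eventually (gt_mem_nhds hδ0)
  obtain ⟨n₀, hn₀⟩ := eventually_atTop.1 hev
  refine ⟨n₀, fun n hn v hv => ?_⟩
  have hpow : ∀ u, ((S.D : G →L[ℝ] G) ^ n) u = S.D^[n] u := fun u => by
    rw [FunLike.coe_pow_eq_iterate]; rfl
  have h1 : ‖(S.D : G →L[ℝ] G) ^ n‖ ≤ C * δ :=
    hbasis hδ0.le fun i => by rw [hpow]; exact (hn₀ n hn i).le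
  rw [← hpow]
  have hM : M < |M| + 1 := lt_of_le_of_lt (le_abs_self M) (lt_add_one _)
  have hCδ : 0 < C * δ := mul_pos hC hδ0
  calc ‖((S.D : G →L[ℝ] G) ^ n) v‖ ≤ ‖(S.D : G →L[ℝ] G) ^ n‖ * ‖v‖ :=
        ContinuousLinearMap.le_opNorm _ _
    _ ≤ C * δ * ‖v‖ := by gcongr
    _ < C * δ * (|M| + 1) := by
        apply mul_lt_mul_of_pos_left (lt_of_le_of_lt hv hM) hCδ
    _ = ε := by rw [hδ]; field_simp

/-! ### Windows -/

theorem exists_iterate_mem_diff {z : E × G} (hz : z ∈ S.lattice) :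
    ∃ n₀, ∀ n ≥ n₀, S.A^[n] z ∈ S.diff := by
  refine S.lattice_induction (p := fun z => ∃ n₀, ∀ n ≥ n₀, S.A^[n] z ∈ S.diff) ?_ ?_ z hz
  · exact fun z hz => ⟨0, fun n _ => S.iterate_mem_diff n hz⟩
  · rintro x y ⟨n, hn⟩ ⟨m, hm⟩
    refine ⟨S.period + max n m, fun k hk => ?_⟩
    obtain ⟨r, rfl⟩ := Nat.exists_eq_add_of_le hk
    rw [add_assoc, Function.iterate_add_apply, iterate_map_add]
    exact S.iterate_period_add_mem_diff (hn _ (by omega)) (hm _ (by omega))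

/-- Every lattice point over a ball of the internal space differs by one of finitely many lattice
points from a point of the base colour; so one power of `A` moves them all into the base colour. -/
theorem exists_iterate_mem_base [CompleteSpace G] (R : ℝ) :
    ∃ k, ∀ z ∈ S.lattice, ‖z.2‖ ≤ R → S.A^[k] z ∈ S.X S.base := by
  obtain ⟨R₀, hR₀⟩ := S.relDense
  obtain ⟨M, hM⟩ := S.exists_bound_base
  have hfin := S.finite_inter (max R₀ (R + M))
  have hex : ∃ n₀, ∀ z ∈ {z : E × G | z ∈ S.lattice ∧ ‖z‖ ≤ max R₀ (R + M)},
      S.A^[n₀] z ∈ S.diff := by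
    have h := fun z (hz : z ∈ {z : E × G | z ∈ S.lattice ∧ ‖z‖ ≤ max R₀ (R + M)}) =>
      eventually_atTop.2 (S.exists_iterate_mem_diff hz.1)
    exact ((Filter.eventually_all_finite hfin).2 h).exists
  obtain ⟨n₀, hn₀⟩ := hex
  refine ⟨S.period + (S.period + n₀), fun z hz hzR => ?_⟩
  obtain ⟨x, hx, hxz⟩ := hR₀ z.1
  have h1 : S.A^[n₀] (z - x) ∈ S.diff := by
    refine hn₀ _ ⟨S.lattice.sub_mem hz (S.mem_lattice _ _ hx), ?_⟩
    rw [Prod.norm_def]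
    refine max_le_max ?_ ?_
    · rw [Prod.fst_sub, norm_sub_rev]; exact hxz
    · exact (norm_sub_le _ _).trans (add_le_add hzR (hM x hx))
  have h2 := S.iterate_mem_diff n₀ (S.mem_diff_of_mem_base hx)
  have h3 := S.iterate_period_mem_base (S.iterate_period_add_mem_diff h1 h2)
  rw [← iterate_map_add, sub_add_cancel] at h3
  rwa [Function.iterate_add_apply, Function.iterate_add_apply]

/-- `X base` contains all lattice points over `D^k` of the unit ball, for a suitable `k`. -/
theorem exists_base_nhd [CompleteSpace G] :
    ∃ V : Set G, IsOpen V ∧ (0 : G) ∈ V ∧ ∀ z ∈ S.lattice, z.2 ∈ V → z ∈ S.X S.base := by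
  obtain ⟨k, hk⟩ := S.exists_iterate_mem_base 1
  have hinv : Function.LeftInverse S.D.symm^[k] S.D^[k] :=
    Function.LeftInverse.iterate S.D.symm_apply_apply _
  refine ⟨S.D.symm^[k] ⁻¹' Metric.ball 0 1, Metric.isOpen_ball.preimage
    (S.D.symm.continuous.iterate k), by simp [iterate_map_zero], fun z hz hzV => ?_⟩
  obtain ⟨w, rfl⟩ := (S.A.surjective.iterate k) z
  refine hk w ((S.map_iterate_mem_iff k w).1 hz) ?_
  rw [A_iterate, Set.mem_preimage, hinv, mem_ball_zero_iff] at hzV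
  exact hzV.le

/-- The composition `z ↦ Aⁿ z + x` that takes `0` to `x` carries the neighbourhood of `0` in the
base window to a neighbourhood of the internal part of `x`. -/
theorem exists_nhd [CompleteSpace G] {i : κ} {x : E × G} (hx : x ∈ S.X i) :
    ∃ V : Set G, IsOpen V ∧ x.2 ∈ V ∧ ∀ z ∈ S.lattice, z.2 ∈ V → z ∈ S.X i := by
  obtain ⟨V, hV, h0, hVX⟩ := S.exists_base_nhd
  obtain ⟨n, -, hn⟩ := S.reach_base i x hx 0
  have hinv : Function.LeftInverse S.D.symm^[n] S.D^[n] :=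
    Function.LeftInverse.iterate S.D.symm_apply_apply _
  refine ⟨(fun v => S.D.symm^[n] (v - x.2)) ⁻¹' V, hV.preimage
    ((S.D.symm.continuous.iterate n).comp (continuous_sub_right _)),
    by simpa [iterate_map_zero] using h0, fun z hz hzV => ?_⟩
  obtain ⟨w, hw⟩ := (S.A.surjective.iterate n) (z - x)
  have hwl : w ∈ S.lattice := by
    rw [← S.map_iterate_mem_iff n, hw]
    exact S.lattice.sub_mem hz (S.mem_lattice i x hx)
  have hwV : w.2 ∈ V := by
    rw [Set.mem_preimage, ← Prod.snd_sub, ← hw, A_iterate] at hzV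
    dsimp only at hzV
    rwa [hinv] at hzV
  have := Reach.mem S hn w (hVX w hwl hwV)
  rwa [hw, sub_add_cancel] at this

/-- The largest open set containing the internal part of no lattice point outside `X i`. -/
def window (i : κ) : Set G :=
  ⋃₀ {V | IsOpen V ∧ ∀ z ∈ S.lattice, z.2 ∈ V → z ∈ S.X i}

theorem isOpen_window (i : κ) : IsOpen (S.window i) := isOpen_sUnion fun _ h => h.1

theorem subset_window {i : κ} {V : Set G} (hV : IsOpen V)
    (h : ∀ z ∈ S.lattice, z.2 ∈ V → z ∈ S.X i) : V ⊆ S.window i :=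
  Set.subset_sUnion_of_mem ⟨hV, h⟩

theorem mem_of_mem_window {i : κ} {z : E × G} (hz : z ∈ S.lattice) (h : z.2 ∈ S.window i) :
    z ∈ S.X i := by
  obtain ⟨_, hV, hzV⟩ := h
  exact hV.2 z hz hzV

theorem mem_window [CompleteSpace G] {i : κ} {x : E × G} (hx : x ∈ S.X i) :
    x.2 ∈ S.window i := by
  obtain ⟨V, hV, hxV, h⟩ := S.exists_nhd hx
  exact S.subset_window hV h hxV

theorem closure_window [CompleteSpace G] (i : κ) :
    closure (S.window i) = closure (Prod.snd '' S.X i) := by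
  apply subset_antisymm
  · refine closure_minimal ?_ isClosed_closure
    refine (S.dense.open_subset_closure_inter (S.isOpen_window i)).trans (closure_mono ?_)
    rintro _ ⟨hz, z, hzl, rfl⟩
    exact ⟨z, S.mem_of_mem_window hzl hz, rfl⟩
  · refine closure_mono ?_
    rintro _ ⟨z, hz, rfl⟩
    exact S.mem_window hz

theorem isCompact_closure_window [FiniteDimensional ℝ G] (i : κ) :
    IsCompact (closure (S.window i)) := by
  have : CompleteSpace G := FiniteDimensional.complete ℝ G
  have : ProperSpace G := FiniteDimensional.proper ℝ G
  obtain ⟨M, hM⟩ := S.exists_bound i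
  rw [closure_window]
  refine Bornology.IsBounded.isCompact_closure (isBounded_iff_forall_norm_le.2 ⟨M, ?_⟩)
  rintro _ ⟨z, hz, rfl⟩
  exact hM z hz

theorem map_window_subset {i k : κ} {a : E × G} (ha : a ∈ S.digits i k) :
    (fun v => S.D v + a.2) '' S.window k ⊆ S.window i := by
  have hal : a ∈ S.lattice := by
    obtain ⟨y, hy⟩ := S.X_nonempty k
    have h1 := S.mem_lattice _ _ (S.map_add_digit_mem ha hy)
    have h2 := (S.map_mem_iff y).2 (S.mem_lattice _ _ hy)
    simpa [A] using S.lattice.sub_mem h1 h2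
  have himg : (fun v => S.D v + a.2) '' S.window k =
      (fun v => S.D.symm (v - a.2)) ⁻¹' S.window k := by
    ext v
    constructor
    · rintro ⟨u, hu, rfl⟩; simpa using hu
    · intro hv; exact ⟨_, hv, by simp⟩
  rw [himg]
  refine S.subset_window ((S.isOpen_window k).preimage
    (S.D.symm.continuous.comp (continuous_sub_right _))) fun z hz hzV => ?_
  obtain ⟨w, hw⟩ := S.A.surjective (z - a)
  have hwl : w ∈ S.lattice := by
    rw [← S.map_mem_iff]
    change S.A w ∈ _
    rw [hw]
    exact S.lattice.sub_mem hz hal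
  have hwV : w.2 ∈ S.window k := by
    have h2 : (S.A w).2 = z.2 - a.2 := by rw [hw]; rfl
    rw [Set.mem_preimage, ← h2] at hzV
    simpa [A] using hzV
  have := S.map_add_digit_mem ha (S.mem_of_mem_window hwl hwV)
  rwa [hw, sub_add_cancel] at this

theorem closure_window_subset [Fintype κ] [CompleteSpace G] (i : κ) :
    closure (S.window i) ⊆
      ⋃ k, ⋃ a ∈ S.digits i k, (fun v => S.D v + a.2) '' closure (S.window k) := by
  have hclosed : IsClosed (⋃ k, ⋃ a ∈ S.digits i k,
      (fun v => S.D v + a.2) '' closure (S.window k)) := by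
    refine isClosed_iUnion_of_finite fun k => ?_
    refine Set.Finite.isClosed_biUnion (S.digits i k).finite_toSet fun a _ => ?_
    exact (S.D.toHomeomorph.trans (Homeomorph.addRight a.2)).isClosedMap _ isClosed_closure
  rw [closure_window]
  refine closure_minimal ?_ hclosed
  rintro _ ⟨x, hx, rfl⟩
  obtain ⟨k, a, ha, y, hy, rfl⟩ := (S.mem_iff i x).1 hx
  simp only [Set.mem_iUnion]
  exact ⟨k, a, ha, y.2, subset_closure (S.mem_window hy), rfl⟩

theorem frontier_window_subset [Fintype κ] [CompleteSpace G] (i : κ) :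
    frontier (S.window i) ⊆
      ⋃ k, ⋃ a ∈ S.digits i k, (fun v => S.D v + a.2) '' frontier (S.window k) := by
  intro v hv
  rw [(S.isOpen_window i).frontier_eq] at hv
  have h := S.closure_window_subset i hv.1
  simp only [Set.mem_iUnion] at h ⊢
  obtain ⟨k, a, ha, u, hu, rfl⟩ := h
  refine ⟨k, a, ha, u, ?_, rfl⟩
  rw [(S.isOpen_window k).frontier_eq]
  exact ⟨hu, fun hu' => hv.2 (S.map_window_subset ha ⟨u, hu', rfl⟩)⟩

/-! ### The boundary of the windows -/

/-- The piece `D ∂U_k + Ψ(a)` of a boundary, for a colour `k` and a digit `a`. -/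
def piece (p : Σ _ : κ, E × G) : Set G := (fun v => S.D v + p.2.2) '' frontier (S.window p.1)

theorem frontier_window_subset_piece [Fintype κ] [FiniteDimensional ℝ G] (i : κ) :
    frontier (S.window i) ⊆ ⋃ p ∈ Finset.univ.sigma (S.digits i), S.piece p := by
  have : CompleteSpace G := FiniteDimensional.complete ℝ G
  intro v hv
  have h := S.frontier_window_subset i hv
  simp only [Set.mem_iUnion] at h ⊢
  obtain ⟨k, a, ha, h⟩ := h
  exact ⟨⟨k, a⟩, by simpa using ha, h⟩

theorem det_pos : 0 < |(S.D : G →ₗ[ℝ] G).det| :=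
  abs_pos.2 (LinearEquiv.isUnit_det' S.D.toLinearEquiv).ne_zero

theorem measure_frontier_window_ne_top [MeasurableSpace G] [FiniteDimensional ℝ G] (μ : Measure G)
    [μ.IsAddHaarMeasure] (i : κ) : μ (frontier (S.window i)) ≠ ⊤ :=
  ((measure_mono frontier_subset_closure).trans_lt
    (S.isCompact_closure_window i).measure_lt_top).ne

section Measure

variable [MeasurableSpace G] [BorelSpace G] [FiniteDimensional ℝ G] (μ : Measure G)
  [μ.IsAddHaarMeasure]

theorem measure_map_add (s : Set G) (c : G) :
    μ ((fun v => S.D v + c) '' s) = ENNReal.ofReal |(S.D : G →ₗ[ℝ] G).det| * μ s := by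
  have h : (fun v => S.D v + c) '' s = (fun v => v + c) '' ((S.D : G →ₗ[ℝ] G) '' s) := by
    rw [Set.image_image]; rfl
  rw [h, Set.image_add_right, measure_preimage_add_right, Measure.addHaar_image_linearMap]

theorem measure_map_add_eq_zero_iff (s : Set G) (c : G) :
    μ ((fun v => S.D v + c) '' s) = 0 ↔ μ s = 0 := by
  rw [S.measure_map_add]
  simp [(abs_pos.1 S.det_pos)]

theorem measure_iterate_add_eq_zero_iff (n : ℕ) (s : Set G) (c : G) :
    μ ((fun v => S.D^[n] v + c) '' s) = 0 ↔ μ s = 0 := by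
  induction n generalizing s c with
  | zero => simp
  | succ n ih =>
    have h : (fun v => S.D^[n + 1] v + c) '' s =
        (fun v => S.D^[n] v + c) '' ((fun v => S.D v + 0) '' s) := by
      rw [Set.image_image]; simp
    rw [h, ih, S.measure_map_add_eq_zero_iff]

theorem measure_piece_ne_top (p : Σ _ : κ, E × G) : μ (S.piece p) ≠ ⊤ := by
  rw [piece, S.measure_map_add]
  exact ENNReal.mul_ne_top ENNReal.ofReal_ne_top (S.measure_frontier_window_ne_top μ _)

variable [Fintype κ]

theorem sum_measureReal_piece (i : κ) :
    ∑ p ∈ Finset.univ.sigma (S.digits i), μ.real (S.piece p) =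
      |(S.D : G →ₗ[ℝ] G).det| * ∑ k, (S.digits i k).card * μ.real (frontier (S.window k)) := by
  rw [Finset.sum_sigma, Finset.mul_sum]
  refine Finset.sum_congr rfl fun k _ => ?_
  have h : ∀ a ∈ S.digits i k, μ.real (S.piece ⟨k, a⟩) =
      |(S.D : G →ₗ[ℝ] G).det| * μ.real (frontier (S.window k)) := by
    intro a _
    rw [measureReal_def, piece, S.measure_map_add, ENNReal.toReal_mul,
      ENNReal.toReal_ofReal (abs_nonneg _), measureReal_def]
  rw [Finset.sum_congr rfl h, Finset.sum_const, nsmul_eq_mul]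
  ring

theorem measure_frontier_window_le (i : κ) :
    μ.real (frontier (S.window i)) ≤
      ∑ p ∈ Finset.univ.sigma (S.digits i), μ.real (S.piece p) :=
  (measureReal_mono (S.frontier_window_subset_piece i)
    ((measure_biUnion_lt_top (Finset.finite_toSet _)
      fun p _ => (S.measure_piece_ne_top μ p).lt_top).ne)).trans
    (measureReal_biUnion_finset_le _ _)

/-- A positive weight that is subinvariant under the substitution matrix, scaled by `|det D|`,
forces the subdivision of the boundaries to be exact in measure. -/
theorem sum_measure_piece_eq {w : κ → ℝ} (hw : ∀ i, 0 < w i)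
    (hwD : ∀ k, |(S.D : G →ₗ[ℝ] G).det| * ∑ i, (S.digits i k).card * w i ≤ w k) (i : κ) :
    ∑ p ∈ Finset.univ.sigma (S.digits i), μ.real (S.piece p) =
      μ.real (frontier (S.window i)) := by
  set b : κ → ℝ := fun i => μ.real (frontier (S.window i)) with hb
  set t : κ → ℝ := fun i => ∑ p ∈ Finset.univ.sigma (S.digits i), μ.real (S.piece p) with ht
  have hbt : ∀ i, b i ≤ t i := S.measure_frontier_window_le μ
  have hsum : ∑ i, w i * (t i - b i) ≤ 0 := by
    have h1 : ∑ i, w i * t i =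
        ∑ k, (|(S.D : G →ₗ[ℝ] G).det| * ∑ i, (S.digits i k).card * w i) * b k := by
      simp only [ht, sum_measureReal_piece, Finset.mul_sum, Finset.sum_mul]
      rw [Finset.sum_comm]
      refine Finset.sum_congr rfl fun _ _ => Finset.sum_congr rfl fun _ _ => ?_
      ring
    have h2 : ∑ i, w i * t i ≤ ∑ k, w k * b k := by
      rw [h1]
      exact Finset.sum_le_sum fun k _ => mul_le_mul_of_nonneg_right (hwD k) measureReal_nonneg
    simp only [mul_sub, Finset.sum_sub_distrib]
    linarith
  have hnn : ∀ i ∈ Finset.univ, 0 ≤ w i * (t i - b i) := fun i _ =>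
    mul_nonneg (hw i).le (sub_nonneg.2 (hbt i))
  have h0 := (Finset.sum_eq_zero_iff_of_nonneg hnn).1
    (le_antisymm hsum (Finset.sum_nonneg hnn)) i (Finset.mem_univ i)
  rcases mul_eq_zero.1 h0 with h | h
  · exact absurd h (hw i).ne'
  · exact sub_eq_zero.1 h

theorem measure_piece_diff {w : κ → ℝ} (hw : ∀ i, 0 < w i)
    (hwD : ∀ k, |(S.D : G →ₗ[ℝ] G).det| * ∑ i, (S.digits i k).card * w i ≤ w k)
    {i k : κ} {a : E × G} (ha : a ∈ S.digits i k) :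
    μ (((fun v => S.D v + a.2) '' frontier (S.window k)) \ frontier (S.window i)) = 0 := by
  classical
  set T := Finset.univ.sigma (S.digits i) with hT
  have hmem : (⟨k, a⟩ : Σ _ : κ, E × G) ∈ T := by simpa [hT] using ha
  have heq := S.sum_measure_piece_eq μ hw hwD i
  rw [← hT, ← Finset.add_sum_erase _ _ hmem] at heq
  set Q := S.piece ⟨k, a⟩ with hQ
  have hsub : frontier (S.window i) ⊆
      (Q ∩ frontier (S.window i)) ∪ ⋃ p ∈ T.erase ⟨k, a⟩, S.piece p := by
    intro v hv
    have h := S.frontier_window_subset_piece i hv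
    simp only [Set.mem_iUnion] at h
    obtain ⟨p, hp, hvp⟩ := h
    by_cases hpe : p = ⟨k, a⟩
    · subst hpe; exact Or.inl ⟨hvp, hv⟩
    · right
      simp only [Set.mem_iUnion]
      exact ⟨p, Finset.mem_erase.2 ⟨hpe, hp⟩, hvp⟩
  have hQtop : μ Q ≠ ⊤ := S.measure_piece_ne_top μ _
  have hQi : μ (Q ∩ frontier (S.window i)) ≠ ⊤ := ne_top_of_le_ne_top hQtop
    (measure_mono Set.inter_subset_left)
  have hU : μ (⋃ p ∈ T.erase ⟨k, a⟩, S.piece p) ≠ ⊤ :=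
    (measure_biUnion_lt_top (Finset.finite_toSet _)
      fun p _ => (S.measure_piece_ne_top μ p).lt_top).ne
  have h1 := (measureReal_mono hsub (measure_union_ne_top hQi hU)).trans
    (measureReal_union_le (μ := μ) _ _)
  have h2 := measureReal_biUnion_finset_le (μ := μ) (T.erase ⟨k, a⟩) S.piece
  have h3 := measureReal_inter_add_sdiff (μ := μ) (s := Q)
    (measurableSet_frontier (s := S.window i)) hQtop
  have h4 : μ.real (Q \ frontier (S.window i)) ≤ 0 := by linarith
  have h5 : μ (Q \ frontier (S.window i)) ≠ ⊤ := ne_top_of_le_ne_top hQtop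
    (measure_mono Set.sdiff_subset)
  exact (measureReal_eq_zero_iff h5).1 (le_antisymm h4 measureReal_nonneg)

theorem Reach.measure_diff {w : κ → ℝ} (hw : ∀ i, 0 < w i)
    (hwD : ∀ k, |(S.D : G →ₗ[ℝ] G).det| * ∑ i, (S.digits i k).card * w i ≤ w k)
    {n : ℕ} {i k : κ} {a : E × G} (h : S.Reach n i k a) :
    μ (((fun v => S.D^[n] v + a.2) '' frontier (S.window k)) \ frontier (S.window i)) = 0 := by
  induction h with
  | refl i => simp
  | @step n i k l a b ha _ ih =>
    have h1 := S.measure_piece_diff μ hw hwD ha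
    have h2 := (S.measure_map_add_eq_zero_iff μ _ a.2).2 ih
    refine measure_mono_null ?_ (measure_union_null h1 h2)
    rintro _ ⟨⟨v, hv, rfl⟩, hv'⟩
    have heq : S.D^[n + 1] v + (S.A b + a).2 = S.D (S.D^[n] v + b.2) + a.2 := by
      rw [Function.iterate_succ_apply', map_add, add_assoc]; rfl
    dsimp only at hv' ⊢
    rw [heq] at hv' ⊢
    by_cases hk : S.D^[n] v + b.2 ∈ frontier (S.window k)
    · exact Or.inl ⟨⟨_, hk, rfl⟩, hv'⟩
    · exact Or.inr ⟨_, ⟨⟨v, hv, rfl⟩, hk⟩, rfl⟩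

/-- The boundary of the base window is null: some `Dⁿ` is one of the maps of the substitution and
takes the boundary into the interior of the window, yet by exactness almost into the boundary. -/
theorem measure_frontier_window_base {w : κ → ℝ} (hw : ∀ i, 0 < w i)
    (hwD : ∀ k, |(S.D : G →ₗ[ℝ] G).det| * ∑ i, (S.digits i k).card * w i ≤ w k) :
    μ (frontier (S.window S.base)) = 0 := by
  have : CompleteSpace G := FiniteDimensional.complete ℝ G
  have h0 : (0 : G) ∈ S.window S.base := S.mem_window S.zero_mem
  obtain ⟨ε, hε, hball⟩ := Metric.isOpen_iff.1 (S.isOpen_window S.base) 0 h0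
  obtain ⟨M, hM⟩ := isBounded_iff_forall_norm_le.1 (S.isCompact_closure_window S.base).isBounded
  obtain ⟨m, hm⟩ := S.exists_forall_norm_iterate_lt M hε
  obtain ⟨n, hn, hreach⟩ := S.reach_base S.base 0 S.zero_mem m
  have h := Reach.measure_diff S μ hw hwD hreach
  rw [Disjoint.sdiff_eq_left ?_] at h
  · exact (S.measure_iterate_add_eq_zero_iff μ n _ _).1 h
  · rw [Set.disjoint_left]
    rintro _ ⟨v, hv, rfl⟩ hv'
    rw [(S.isOpen_window S.base).frontier_eq] at hv'
    refine hv'.2 (hball ?_)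
    rw [mem_ball_zero_iff]
    simpa using hm n hn v (hM v (frontier_subset_closure hv))

theorem measure_frontier_window {w : κ → ℝ} (hw : ∀ i, 0 < w i)
    (hwD : ∀ k, |(S.D : G →ₗ[ℝ] G).det| * ∑ i, (S.digits i k).card * w i ≤ w k) (i : κ) :
    μ (frontier (S.window i)) = 0 := by
  obtain ⟨n, a, h⟩ := S.exists_reach S.base i
  have h1 := Reach.measure_diff S μ hw hwD h
  have h2 := S.measure_frontier_window_base μ hw hwD
  rw [← S.measure_iterate_add_eq_zero_iff μ n _ a.2]
  refine measure_mono_null ?_ (measure_union_null h1 h2)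
  intro v hv
  by_cases hvb : v ∈ frontier (S.window S.base)
  · exact Or.inr hvb
  · exact Or.inl ⟨hv, hvb⟩

end Measure

end LiftedKSet

/-! ### Control points of substitution tilings -/

namespace SubstTiling

variable {d κ : ℕ}

theorem Tile.add_vadd' (g h : Rd d) (T : Tile d κ) : (g + h) +ᵥ T = g +ᵥ (h +ᵥ T) := by
  ext x
  · change x ∈ (fun x => g + h + x) '' T.supp ↔ x ∈ (fun x => g + x) '' ((fun x => h + x) '' T.supp)
    rw [Set.image_image]; simp only [add_assoc]
  · rfl

theorem Tile.vadd_supp (g : Rd d) (T : Tile d κ) : (g +ᵥ T).supp = (fun x => g + x) '' T.supp := rfl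

theorem Tile.interior_vadd_supp (g : Rd d) (T : Tile d κ) :
    interior (g +ᵥ T).supp = (fun x => g + x) '' interior T.supp :=
  ((Homeomorph.addLeft g).image_interior T.supp).symm

theorem Tile.interior_nonempty (T : Tile d κ) : (interior T.supp).Nonempty := by
  rw [← closure_nonempty_iff, T.closure_interior]
  exact T.nonempty

variable {φ : Module.End ℝ (Rd d)} {ω : TileSubstitution κ φ} {𝒯 : Set (Tile d κ)}
  {γ : Tile d κ → Tile d κ} {c : Tile d κ → Rd d}

theorem TileSubstitution.IsSubstitutionTiling.onTile_subset (h𝒯 : ω.IsSubstitutionTiling 𝒯)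
    {T : Tile d κ} (hT : T ∈ 𝒯) : ω.onTile T ⊆ 𝒯 := by
  intro T' hT'
  rw [← h𝒯.fixed]
  exact Set.mem_biUnion hT hT'

theorem TileSubstitution.vadd_mem_onTile (ω : TileSubstitution κ φ) {x u : Rd d} {i k : Fin κ}
    (hu : u ∈ ω.digits i k) : (φ x + u) +ᵥ ω.proto i ∈ ω.onTile (x +ᵥ ω.proto k) :=
  ⟨x, k, i, rfl, u, hu, rfl⟩

theorem TileSubstitution.exists_digit (ω : TileSubstitution κ φ) (k : Fin κ) :
    ∃ i, (ω.digits i k).Nonempty := by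
  obtain ⟨x, hx⟩ := (ω.proto k).nonempty.image φ
  rw [ω.subdivision k] at hx
  simp only [Set.mem_iUnion] at hx
  obtain ⟨i, u, hu, -⟩ := hx
  exact ⟨i, u, hu⟩

/-- Control points are translation equivariant. -/
theorem IsControlPointMap.map_vadd (hc : IsControlPointMap φ 𝒯 γ c)
    (h𝒯 : ω.IsSubstitutionTiling 𝒯) (hγ : ω.IsTileMap 𝒯 γ) {T : Tile d κ} (hT : T ∈ 𝒯) {g : Rd d}
    (hgT : g +ᵥ T ∈ 𝒯) : c (g +ᵥ T) = g + c T := by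
  have hmem : ∀ T ∈ 𝒯, ∀ m, γ^[m] T ∈ 𝒯 := by
    intro T hT m
    induction m with
    | zero => exact hT
    | succ m ih =>
      rw [Function.iterate_succ_apply']
      exact h𝒯.onTile_subset ih (hγ.mem _ ih)
  have hiter : ∀ m, γ^[m] (g +ᵥ T) = (φ ^ m) g +ᵥ γ^[m] T := by
    intro m
    induction m with
    | zero => rfl
    | succ m ih =>
      have h1 := hmem _ hgT m
      rw [ih] at h1
      rw [Function.iterate_succ_apply', ih, hγ.relative _ (hmem T hT m) _ h1,
        Function.iterate_succ_apply', pow_succ']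
      rfl
  have h1 : c T ∈ ⋂ m : ℕ, ⇑(φ ^ m) ⁻¹' (γ^[m] T).supp := by rw [← hc T hT]; rfl
  have h2 : g + c T ∈ ⋂ m : ℕ, ⇑(φ ^ m) ⁻¹' (γ^[m] (g +ᵥ T)).supp := by
    simp only [Set.mem_iInter, Set.mem_preimage] at h1 ⊢
    intro m
    rw [hiter, Tile.vadd_supp, map_add]
    exact ⟨_, h1 m, rfl⟩
  rw [← hc _ hgT] at h2
  exact (Set.mem_singleton_iff.1 h2).symm

/-- The position of the control point of a tile of colour `i` relative to the prototile `T_i`. -/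
theorem exists_control_offset (h𝒯 : ω.IsSubstitutionTiling 𝒯) (hγ : ω.IsTileMap 𝒯 γ)
    (hc : IsControlPointMap φ 𝒯 γ c) :
    ∃ t : Fin κ → Rd d, ∀ i, ∀ x : Rd d, x +ᵥ ω.proto i ∈ 𝒯 → c (x +ᵥ ω.proto i) = x + t i := by
  have h : ∀ i, ∃ t : Rd d, ∀ x : Rd d, x +ᵥ ω.proto i ∈ 𝒯 → c (x +ᵥ ω.proto i) = x + t := by
    intro i
    by_cases hex : ∃ y : Rd d, y +ᵥ ω.proto i ∈ 𝒯
    · obtain ⟨y, hy⟩ := hex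
      refine ⟨c (y +ᵥ ω.proto i) - y, fun x hx => ?_⟩
      have h1 : x +ᵥ ω.proto i = (x - y) +ᵥ (y +ᵥ ω.proto i) := by
        rw [← Tile.add_vadd', sub_add_cancel]
      rw [h1, hc.map_vadd h𝒯 hγ hy (h1 ▸ hx)]
      abel
    · exact ⟨0, fun x hx => absurd ⟨x, hx⟩ hex⟩
  choose t ht using h
  exact ⟨t, ht⟩

theorem mem_controlPoints_iff (h𝒯 : ω.IsSubstitutionTiling 𝒯) {t : Fin κ → Rd d}
    (ht : ∀ i, ∀ x : Rd d, x +ᵥ ω.proto i ∈ 𝒯 → c (x +ᵥ ω.proto i) = x + t i) (i : Fin κ)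
    (p : Rd d) : p ∈ controlPoints 𝒯 c i ↔ ∃ x : Rd d, x +ᵥ ω.proto i ∈ 𝒯 ∧ p = x + t i := by
  constructor
  · rintro ⟨T, ⟨hT, rfl⟩, rfl⟩
    obtain ⟨x, hx⟩ := h𝒯.translate_proto T hT
    refine ⟨x, hx ▸ hT, ?_⟩
    rw [← ht _ _ (hx ▸ hT), ← hx]
  · rintro ⟨x, hx, rfl⟩
    exact ⟨_, ⟨hx, ω.color_proto i⟩, ht i x hx⟩

/-- The digits of the control points, computed from the digits of the substitution. -/
theorem mem_controlDigits_iff (h𝒯 : ω.IsSubstitutionTiling 𝒯) {t : Fin κ → Rd d}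
    (ht : ∀ i, ∀ x : Rd d, x +ᵥ ω.proto i ∈ 𝒯 → c (x +ᵥ ω.proto i) = x + t i)
    (i k : Fin κ) (hk : (controlPoints 𝒯 c k).Nonempty) (a : Rd d) :
    a ∈ controlDigits ω 𝒯 c i k ↔ ∃ u ∈ ω.digits i k, a = u + t i - φ (t k) := by
  constructor
  · rintro ⟨T, hT, rfl, T', hT', rfl, rfl⟩
    have hT'𝒯 := h𝒯.onTile_subset hT hT'
    obtain ⟨x, k, i, rfl, u, hu, rfl⟩ := hT'
    have hk : (x +ᵥ ω.proto k).color = k := ω.color_proto k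
    have hi : ((φ x + u) +ᵥ ω.proto i).color = i := ω.color_proto i
    rw [hk, hi, ht _ _ hT, ht _ _ hT'𝒯]
    exact ⟨u, hu, by rw [map_add]; abel⟩
  · rintro ⟨u, hu, rfl⟩
    obtain ⟨p, hp⟩ := hk
    obtain ⟨x, hx, -⟩ := (mem_controlPoints_iff h𝒯 ht k p).1 hp
    have hmem := ω.vadd_mem_onTile (x := x) hu
    refine ⟨_, hx, ω.color_proto k, _, hmem, ω.color_proto i, ?_⟩
    rw [ht _ _ hx, ht _ _ (h𝒯.onTile_subset hx hmem), map_add]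
    abel

/-- The control points are fixed by their `κ`-set substitution. -/
theorem kSetSubst_controlPoints (h𝒯 : ω.IsSubstitutionTiling 𝒯) (hγ : ω.IsTileMap 𝒯 γ)
    (hc : IsControlPointMap φ 𝒯 γ c) :
    kSetSubst φ (controlDigits ω 𝒯 c) (controlPoints 𝒯 c) = controlPoints 𝒯 c := by
  obtain ⟨t, ht⟩ := exists_control_offset h𝒯 hγ hc
  funext i
  ext p
  constructor
  · rintro ⟨k, a, ha, y, hy, rfl⟩
    obtain ⟨u, hu, rfl⟩ := (mem_controlDigits_iff h𝒯 ht i k ⟨y, hy⟩ a).1 ha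
    obtain ⟨x, hx, rfl⟩ := (mem_controlPoints_iff h𝒯 ht k y).1 hy
    refine (mem_controlPoints_iff h𝒯 ht i _).2
      ⟨φ x + u, h𝒯.onTile_subset hx (ω.vadd_mem_onTile hu), ?_⟩
    rw [map_add]; abel
  · rintro ⟨T, ⟨hT, rfl⟩, rfl⟩
    have hT' := hT
    rw [← h𝒯.fixed] at hT'
    simp only [Set.mem_iUnion] at hT'
    obtain ⟨T₀, hT₀, hTT₀⟩ := hT'
    exact ⟨T₀.color, c T - φ (c T₀), ⟨T₀, hT₀, rfl, T, hTT₀, rfl, rfl⟩, c T₀,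
      ⟨T₀, ⟨hT₀, rfl⟩, rfl⟩, by abel⟩

theorem substMatrix_pos_iff (ω : TileSubstitution κ φ) (i k : Fin κ) :
    0 < ω.substMatrix i k ↔ (ω.digits i k).Nonempty := by
  simp [TileSubstitution.substMatrix, Finset.card_pos]

/-- Induction along the paths in the graph of a primitive substitution. -/
theorem TileSubstitution.IsPrimitive.induction (hprim : ω.IsPrimitive) {p : Fin κ → Prop}
    {k : Fin κ} (hk : p k) (hstep : ∀ i l, (ω.digits i l).Nonempty → p l → p i) (i : Fin κ) :
    p i := by
  obtain ⟨n, -, hn⟩ := hprim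
  have key : ∀ n i, 0 < (ω.substMatrix ^ n) i k → p i := by
    intro n
    induction n with
    | zero =>
      intro i hi
      rw [pow_zero, Matrix.one_apply] at hi
      split_ifs at hi with h
      · exact h ▸ hk
      · exact absurd hi (lt_irrefl _)
    | succ n ih =>
      intro i hi
      rw [pow_succ', Matrix.mul_apply] at hi
      obtain ⟨l, -, hl⟩ := Finset.exists_ne_zero_of_sum_ne_zero hi.ne'
      have hl' := mul_ne_zero_iff.1 hl
      exact hstep i l ((substMatrix_pos_iff ω i l).1 (Nat.pos_of_ne_zero hl'.1))
        (ih l (Nat.pos_of_ne_zero hl'.2))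
  exact key n i (hn i k)

theorem controlPoints_nonempty (h𝒯 : ω.IsSubstitutionTiling 𝒯) (hprim : ω.IsPrimitive)
    (hγ : ω.IsTileMap 𝒯 γ) (hc : IsControlPointMap φ 𝒯 γ c) {j : Fin κ}
    (hj : (controlPoints 𝒯 c j).Nonempty) (i : Fin κ) : (controlPoints 𝒯 c i).Nonempty := by
  obtain ⟨t, ht⟩ := exists_control_offset h𝒯 hγ hc
  refine hprim.induction (p := fun i => (controlPoints 𝒯 c i).Nonempty) hj ?_ i
  rintro i l ⟨u, hu⟩ ⟨y, hy⟩
  rw [← kSetSubst_controlPoints h𝒯 hγ hc]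
  exact ⟨_, l, _, (mem_controlDigits_iff h𝒯 ht i l ⟨y, hy⟩ _).2 ⟨u, hu, rfl⟩, y, hy, rfl⟩

theorem controlPoints_relDense (h𝒯 : ω.IsSubstitutionTiling 𝒯) (hrep : IsRepetitive 𝒯)
    (hγ : ω.IsTileMap 𝒯 γ) (hc : IsControlPointMap φ 𝒯 γ c) {j : Fin κ}
    (hj : (controlPoints 𝒯 c j).Nonempty) :
    ∃ R : ℝ, ∀ v, ∃ x ∈ controlPoints 𝒯 c j, ‖x - v‖ ≤ R := by
  obtain ⟨_, T, ⟨hT, rfl⟩, rfl⟩ := hj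
  obtain ⟨R, hR⟩ := hrep {T} (Set.finite_singleton T) (by simpa using hT)
  refine ⟨R, fun v => ?_⟩
  obtain ⟨g, hg, hgT⟩ := hR (v - c T)
  have hgT := hgT T rfl
  refine ⟨c (g +ᵥ T), ⟨_, ⟨hgT, rfl⟩, rfl⟩, ?_⟩
  rw [hc.map_vadd h𝒯 hγ hT hgT]
  rw [dist_eq_norm] at hg
  have h1 : g + c T - v = g - (v - c T) := by abel
  rwa [h1]

/-- Two control points of the same colour are at least as far apart as the radius of a ball inside
the prototile. -/
theorem controlPoints_separated (h𝒯 : ω.IsSubstitutionTiling 𝒯) {t : Fin κ → Rd d}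
    (ht : ∀ i, ∀ x : Rd d, x +ᵥ ω.proto i ∈ 𝒯 → c (x +ᵥ ω.proto i) = x + t i) (j : Fin κ) :
    ∃ r : ℝ, 0 < r ∧ ∀ x ∈ controlPoints 𝒯 c j, ∀ y ∈ controlPoints 𝒯 c j, x ≠ y →
      r ≤ dist x y := by
  obtain ⟨p, hp⟩ := (ω.proto j).interior_nonempty
  obtain ⟨r, hr, hball⟩ := Metric.isOpen_iff.1 isOpen_interior p hp
  refine ⟨r, hr, fun x hx y hy hxy => ?_⟩
  obtain ⟨x, hxT, rfl⟩ := (mem_controlPoints_iff h𝒯 ht j x).1 hx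
  obtain ⟨y, hyT, rfl⟩ := (mem_controlPoints_iff h𝒯 ht j y).1 hy
  by_contra! hlt
  have hne : x +ᵥ ω.proto j ≠ y +ᵥ ω.proto j := by
    intro h
    apply hxy
    rw [← ht j x hxT, ← ht j y hyT, h]
  have hdisj := h𝒯.isTiling.disjoint _ hxT _ hyT hne
  rw [Tile.interior_vadd_supp, Tile.interior_vadd_supp, Set.disjoint_left] at hdisj
  refine hdisj (a := x + p) ⟨p, hp, rfl⟩ ⟨x - y + p, hball ?_, by dsimp only; abel⟩
  rw [Metric.mem_ball, dist_eq_norm, add_sub_cancel_right]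
  rwa [dist_eq_norm, add_sub_add_right_eq_sub] at hlt

/-- The volumes of the interiors of the prototiles are a subinvariant weight. -/
theorem sum_card_digits_mul_volume_le (ω : TileSubstitution κ φ) (hφ : LinearMap.det φ ≠ 0)
    (k : Fin κ) :
    ∑ i, ((ω.digits i k).card : ℝ) * volume.real (interior (ω.proto i).supp) ≤
      |LinearMap.det φ| * volume.real (interior (ω.proto k).supp) := by
  let e : Rd d ≃L[ℝ] Rd d := (LinearMap.equivOfDetNeZero φ hφ).toContinuousLinearEquiv
  have he : ⇑e = φ := rfl
  have hfin : ∀ i, volume (interior (ω.proto i).supp) ≠ ⊤ := fun i =>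
    ((measure_mono interior_subset).trans_lt (ω.proto i).isCompact.measure_lt_top).ne
  have hsub : (⋃ p ∈ Finset.univ.sigma (fun i => ω.digits i k),
      interior (p.2 +ᵥ ω.proto p.1).supp) ⊆ φ '' interior (ω.proto k).supp := by
    have h1 : φ '' interior (ω.proto k).supp = interior (φ '' (ω.proto k).supp) :=
      e.toHomeomorph.image_interior _
    rw [h1]
    refine Set.iUnion₂_subset fun p hp => interior_mono ?_
    rw [ω.subdivision k]
    intro v hv
    simp only [Set.mem_iUnion]
    exact ⟨p.1, p.2, by simpa using hp, hv⟩
  have himg : volume (φ '' interior (ω.proto k).supp) =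
      ENNReal.ofReal |LinearMap.det φ| * volume (interior (ω.proto k).supp) :=
    Measure.addHaar_image_linearMap volume φ _
  have hle := measureReal_mono (μ := volume) hsub (by
    rw [himg]; exact ENNReal.mul_ne_top ENNReal.ofReal_ne_top (hfin k))
  rw [measureReal_biUnion_finset ?_ (fun p _ => isOpen_interior.measurableSet) ?_,
    Finset.sum_sigma] at hle
  · have h2 : ∀ i, ∑ u ∈ ω.digits i k, volume.real (interior (u +ᵥ ω.proto i).supp) =
        (ω.digits i k).card * volume.real (interior (ω.proto i).supp) := by
      intro i
      rw [← nsmul_eq_mul, ← Finset.sum_const]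
      refine Finset.sum_congr rfl fun u _ => ?_
      rw [Tile.interior_vadd_supp, measureReal_def, Set.image_add_left, measure_preimage_add]
      rfl
    simp only [h2] at hle
    rwa [measureReal_def (s := φ '' _), himg, ENNReal.toReal_mul,
      ENNReal.toReal_ofReal (abs_nonneg _)] at hle
  · intro p hp q hq hpq
    have hp' : p.2 ∈ ω.digits p.1 k := by simpa using hp
    have hq' : q.2 ∈ ω.digits q.1 k := by simpa using hq
    refine ω.disjoint k p.1 q.1 p.2 hp' q.2 hq' fun h => hpq ?_
    obtain ⟨p1, p2⟩ := p
    obtain ⟨q1, q2⟩ := q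
    simpa using h
  · intro p _
    rw [Tile.interior_vadd_supp, Set.image_add_left, measure_preimage_add]
    exact hfin _

theorem volume_interior_proto_pos (ω : TileSubstitution κ φ) (i : Fin κ) :
    0 < volume.real (interior (ω.proto i).supp) :=
  ENNReal.toReal_pos (isOpen_interior.measure_pos _ (ω.proto i).interior_nonempty).ne'
    ((measure_mono interior_subset).trans_lt (ω.proto i).isCompact.measure_lt_top).ne

/-! ### Block matrices -/

section Block

variable {S : Finset ℂ} (hS : ∀ z ∈ S, (starRingEnd ℂ) z ∈ S)

/-- Complex conjugation on the index set of the block matrices. -/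
def conjIndex (z : S) : S := ⟨(starRingEnd ℂ) (z : ℂ), hS z z.2⟩

theorem conjIndex_conjIndex (z : S) : conjIndex hS (conjIndex hS z) = z :=
  Subtype.ext (Complex.conj_conj _)

theorem rootBlock_apply (z w : S) : rootBlock S z w =
    (if w = z then (z : ℂ).re else 0) - (if w = conjIndex hS z then (z : ℂ).im else 0) := by
  simp only [rootBlock, Matrix.of_apply, conjIndex, Subtype.ext_iff]

theorem rootMatrix_mulVec (J : ℕ) (v : S × Fin J → ℝ) (a : S × Fin J) :
    (rootMatrix S J).mulVec v a =
      (a.1 : ℂ).re * v a - (a.1 : ℂ).im * v (conjIndex hS a.1, a.2) := by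
  obtain ⟨z, j⟩ := a
  simp only [rootMatrix, Matrix.mulVec, dotProduct, Matrix.blockDiagonal_apply,
    Fintype.sum_prod_type, rootBlock_apply hS]
  simp [sub_mul, Finset.sum_sub_distrib]

/-- The complex coordinate `v_z + i v_{conj z}` of `v`, an eigenvector of the transposed block
matrix for the eigenvalue `z`. -/
noncomputable def eigenCoord {J : ℕ} (v : S × Fin J → ℝ) (a : S × Fin J) : ℂ :=
  v a + Complex.I * v (conjIndex hS a.1, a.2)

theorem eigenCoord_re {J : ℕ} (v : S × Fin J → ℝ) (a : S × Fin J) :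
    (eigenCoord hS v a).re = v a := by
  simp [eigenCoord]

theorem eigenCoord_injective {J : ℕ} : Function.Injective (eigenCoord hS (J := J)) := by
  intro v w h
  funext a
  rw [← eigenCoord_re hS v, h, eigenCoord_re]

theorem eigenCoord_rootMatrix {J : ℕ} (v : S × Fin J → ℝ) (a : S × Fin J) :
    eigenCoord hS ((rootMatrix S J).mulVec v) a = a.1 * eigenCoord hS v a := by
  have h1 : ((conjIndex hS a.1 : S) : ℂ) = (starRingEnd ℂ) (a.1 : ℂ) := rfl
  simp only [eigenCoord, rootMatrix_mulVec hS, conjIndex_conjIndex, h1, Complex.conj_re,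
    Complex.conj_im]
  apply Complex.ext
  · simp
  · simp

theorem eigenCoord_aeval {J : ℕ} (p : ℝ[X]) (v : S × Fin J → ℝ) (a : S × Fin J) :
    eigenCoord hS ((aeval (rootMatrix S J) p).mulVec v) a =
      aeval (a.1 : ℂ) p * eigenCoord hS v a := by
  have hadd : ∀ u w : S × Fin J → ℝ,
      eigenCoord hS (u + w) a = eigenCoord hS u a + eigenCoord hS w a := by
    intro u w; simp only [eigenCoord, Pi.add_apply]; push_cast; ring
  have hsmul : ∀ (r : ℝ) (u : S × Fin J → ℝ), eigenCoord hS (r • u) a = r * eigenCoord hS u a := by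
    intro r u; simp only [eigenCoord, Pi.smul_apply, smul_eq_mul]; push_cast; ring
  induction p using Polynomial.induction_on' with
  | add p q hp hq => rw [map_add, Matrix.add_mulVec, hadd, hp, hq, map_add]; ring
  | monomial n r =>
    rw [aeval_monomial, aeval_monomial, ← Algebra.smul_def, Matrix.smul_mulVec, hsmul, mul_assoc]
    congr 1
    induction n with
    | zero => simp
    | succ n ih =>
      rw [pow_succ', ← Matrix.mulVec_mulVec, eigenCoord_rootMatrix, ih, pow_succ']; ring

theorem aeval_rootMatrix_eq_zero (hS : ∀ z ∈ S, (starRingEnd ℂ) z ∈ S) (J : ℕ) (p : ℝ[X])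
    (hp : ∀ z ∈ S, aeval z p = 0) :
    aeval (rootMatrix S J) p = 0 := by
  apply Matrix.ext_of_mulVec_single
  intro b
  apply eigenCoord_injective hS
  funext a
  rw [eigenCoord_aeval, hp _ a.1.2]
  simp [eigenCoord]

theorem aeval_rootMatrix_mulVec_injective (hS : ∀ z ∈ S, (starRingEnd ℂ) z ∈ S) (J : ℕ)
    (p : ℝ[X]) (hp : ∀ z ∈ S, aeval z p ≠ 0) :
    Function.Injective (aeval (rootMatrix S J) p).mulVec := by
  intro v w h
  apply eigenCoord_injective hS
  funext a
  have h1 : aeval (a.1 : ℂ) p * eigenCoord hS v a = aeval (a.1 : ℂ) p * eigenCoord hS w a := by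
    rw [← eigenCoord_aeval, ← eigenCoord_aeval, h]
  exact mul_left_cancel₀ (hp _ a.1.2) h1

/-- With `Q` the permutation matrix of conjugation, `1 + iQ` diagonalizes the block matrix, and
`(1 + iQ)(1 - iQ) = 2`. -/
theorem det_rootBlock (hS : ∀ z ∈ S, (starRingEnd ℂ) z ∈ S) :
    ((rootBlock S).det : ℂ) = ∏ z ∈ S, z := by
  set Q : Matrix S S ℂ := Matrix.of fun z w => if w = conjIndex hS z then 1 else 0 with hQ
  have hQmul : ∀ (M : Matrix S S ℂ) (z w : S), (Q * M) z w = M (conjIndex hS z) w := by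
    intro M z w
    simp [hQ, Matrix.mul_apply]
  have hQQ : Q * Q = 1 := by
    ext z w
    rw [hQmul]
    simp [hQ, conjIndex_conjIndex, Matrix.one_apply, eq_comm]
  set Dr : Matrix S S ℂ := Matrix.diagonal fun z => ((z : ℂ).re : ℂ) with hDr
  set Di : Matrix S S ℂ := Matrix.diagonal fun z => ((z : ℂ).im : ℂ) with hDi
  have h1 : Q * Dr = Dr * Q := by
    ext z w
    rw [hQmul, hDr, Matrix.diagonal_mul, Matrix.diagonal_apply]
    by_cases h : conjIndex hS z = w
    · subst h; simp [hQ, conjIndex]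
    · simp [hQ, h, Ne.symm h]
  have h2 : Q * Di = -(Di * Q) := by
    ext z w
    rw [hQmul, Matrix.neg_apply, hDi, Matrix.diagonal_mul, Matrix.diagonal_apply]
    by_cases h : conjIndex hS z = w
    · subst h; simp [hQ, conjIndex]
    · simp [hQ, h, Ne.symm h]
  have hR : (rootBlock S).map (algebraMap ℝ ℂ) = Dr - Di * Q := by
    ext z w
    rw [Matrix.map_apply, rootBlock_apply hS, Matrix.sub_apply, hDi, Matrix.diagonal_mul, hDr,
      Matrix.diagonal_apply]
    simp only [hQ, Matrix.of_apply, eq_comm (a := z) (b := w)]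
    split_ifs <;> simp
  have hz : Dr + Complex.I • Di = Matrix.diagonal fun z : S => (z : ℂ) := by
    ext z w
    rw [Matrix.add_apply, Matrix.smul_apply, hDr, hDi, Matrix.diagonal_apply,
      Matrix.diagonal_apply, Matrix.diagonal_apply]
    by_cases h : z = w
    · simp only [h, if_true, smul_eq_mul]
      rw [mul_comm, Complex.re_add_im]
    · simp [h]
  have hconj : (1 + Complex.I • Q) * (rootBlock S).map (algebraMap ℝ ℂ) =
      (Dr + Complex.I • Di) * (1 + Complex.I • Q) := by
    rw [hR]
    have h3 : Q * (Di * Q) = -Di := by rw [← mul_assoc, h2, neg_mul, mul_assoc, hQQ, mul_one]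
    simp only [add_mul, mul_add, one_mul, mul_one, mul_sub, smul_mul_assoc, mul_smul_comm, h1, h3]
    match_scalars <;> ring_nf <;> simp [Complex.I_sq]
  have hinv : (1 + Complex.I • Q) * (1 - Complex.I • Q) = (2 : ℂ) • 1 := by
    simp only [add_mul, mul_sub, one_mul, mul_one, smul_mul_assoc, mul_smul_comm, hQQ]
    match_scalars <;> ring_nf <;> norm_num [Complex.I_sq]
  have hdet : (1 + Complex.I • Q).det ≠ 0 := by
    intro h0
    have := congrArg Matrix.det hinv
    rw [Matrix.det_mul, h0, zero_mul, Matrix.det_smul, Matrix.det_one, mul_one] at this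
    exact pow_ne_zero _ two_ne_zero this.symm
  have h4 := congrArg Matrix.det hconj
  rw [Matrix.det_mul, Matrix.det_mul, hz, Matrix.det_diagonal, mul_comm] at h4
  have h5 := mul_right_cancel₀ hdet h4
  rw [Finset.prod_coe_sort S (fun z => z)] at h5
  rw [← h5]
  exact (algebraMap ℝ ℂ).map_det _

theorem det_rootMatrix (hS : ∀ z ∈ S, (starRingEnd ℂ) z ∈ S) (J : ℕ) :
    ((rootMatrix S J).det : ℂ) = (∏ z ∈ S, z) ^ J := by
  rw [rootMatrix, Matrix.det_blockDiagonal]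
  push_cast
  rw [det_rootBlock hS]
  simp

end Block

/-! ### The expansion map and its conjugates -/

variable {d J : ℕ} {φ : Module.End ℝ (Rd d)}

theorem mem_eigs_iff (z : ℂ) : z ∈ eigs φ ↔ aeval z φ.charpoly = 0 := by
  rw [eigs, Multiset.mem_toFinset, mem_aroots]
  exact and_iff_right φ.charpoly_monic.ne_zero

theorem conj_mem_eigs : ∀ z ∈ eigs φ, (starRingEnd ℂ) z ∈ eigs φ := by
  intro z hz
  rw [mem_eigs_iff] at hz ⊢
  rw [aeval_conj, hz, map_zero]

theorem map_aeval_apply {σ : Rd d ≃ₗ[ℝ] Physical φ J}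
    (hσ : ∀ x, σ (φ x) = (rootMatrix (eigs φ) J).mulVec (σ x)) (p : ℝ[X]) (x : Rd d) :
    σ (aeval φ p x) = (aeval (rootMatrix (eigs φ) J) p).mulVec (σ x) := by
  induction p using Polynomial.induction_on' with
  | add p q hp hq => simp [hp, hq, Matrix.add_mulVec]
  | monomial n r =>
    rw [aeval_monomial, aeval_monomial, ← Algebra.smul_def, ← Algebra.smul_def,
      Matrix.smul_mulVec, LinearMap.smul_apply, map_smul]
    congr 1
    induction n generalizing x with
    | zero => simp
    | succ n ih =>
      rw [pow_succ, pow_succ, Module.End.mul_apply, ih, hσ, Matrix.mulVec_mulVec]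

theorem eigs_nonempty (hd : 0 < d) (σ : Rd d ≃ₗ[ℝ] Physical φ J) : (eigs φ).Nonempty := by
  by_contra h
  rw [Finset.not_nonempty_iff_eq_empty] at h
  have : IsEmpty (eigs φ) := by rw [h]; infer_instance
  have h1 := σ.finrank_eq
  rw [finrank_euclideanSpace_fin, Module.finrank_fintype_fun_eq_card] at h1
  simp at h1
  omega

/-- The minimal polynomial of `φ` over `ℚ` is the common minimal polynomial of the eigenvalues; it
is irreducible and has integer coefficients. -/
theorem exists_minpoly_eq_map (hd : 0 < d) (hconj : HasConjugateEigenvalues φ J)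
    {σ : Rd d ≃ₗ[ℝ] Physical φ J}
    (hσ : ∀ x, σ (φ x) = (rootMatrix (eigs φ) J).mulVec (σ x)) :
    ∃ p : ℤ[X], p.Monic ∧ minpoly ℚ φ = p.map (algebraMap ℤ ℚ) ∧ Irreducible (minpoly ℚ φ) ∧
      ∀ z ∈ eigs φ, aeval z p = 0 := by
  obtain ⟨z, hz⟩ := eigs_nonempty hd σ
  have hint := hconj.integral z hz
  have hmin := minpoly.isIntegrallyClosed_eq_field_fractions' ℚ hint
  have hroot : ∀ w ∈ eigs φ, aeval w (minpoly ℤ z) = 0 := by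
    intro w hw
    have h1 : minpoly ℚ z = minpoly ℚ w := hconj.conj z hz w hw
    have h2 := minpoly.aeval ℚ w
    rw [← h1, hmin] at h2
    rwa [aeval_map_algebraMap] at h2
  have hφ : aeval φ (minpoly ℤ z) = 0 := by
    rw [← aeval_map_algebraMap ℝ]
    ext1 x
    apply σ.injective
    rw [map_aeval_apply hσ, aeval_rootMatrix_eq_zero conj_mem_eigs]
    · simp
    · intro w hw
      rw [aeval_map_algebraMap]
      exact hroot w hw
  have : Nontrivial (Rd d) := by
    apply Module.nontrivial_of_finrank_pos (R := ℝ)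
    rwa [finrank_euclideanSpace_fin]
  have hirr := minpoly.irreducible (hint.tower_top (A := ℚ))
  have heq : minpoly ℚ z = minpoly ℚ φ := by
    refine minpoly.eq_of_irreducible_of_monic hirr ?_ (minpoly.monic (hint.tower_top (A := ℚ)))
    rw [hmin, aeval_map_algebraMap]
    exact hφ
  exact ⟨minpoly ℤ z, minpoly.monic hint, by rw [← heq, hmin], heq ▸ hirr, hroot⟩

theorem mem_otherConjugates_iff {p : ℤ[X]} (hp : p.Monic)
    (hpφ : minpoly ℚ φ = p.map (algebraMap ℤ ℚ)) (z : ℂ) :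
    z ∈ otherConjugates φ ↔ aeval z p = 0 ∧ z ∉ eigs φ := by
  rw [otherConjugates, Finset.mem_sdiff, Multiset.mem_toFinset, mem_aroots, hpφ,
    aeval_map_algebraMap]
  have : p.map (algebraMap ℤ ℚ) ≠ 0 := (hp.map _).ne_zero
  tauto

theorem conj_mem_otherConjugates {p : ℤ[X]} (hp : p.Monic)
    (hpφ : minpoly ℚ φ = p.map (algebraMap ℤ ℚ)) :
    ∀ z ∈ otherConjugates φ, (starRingEnd ℂ) z ∈ otherConjugates φ := by
  intro z hz
  rw [mem_otherConjugates_iff hp hpφ] at hz ⊢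
  refine ⟨?_, fun h => hz.2 ?_⟩
  · rw [← aeval_map_algebraMap ℝ, aeval_conj, aeval_map_algebraMap, hz.1, map_zero]
  · simpa using conj_mem_eigs _ h

/-- The product of all conjugates is the constant term of the minimal polynomial, up to sign. -/
theorem norm_prod_mul_norm_prod {p : ℤ[X]} (hp : p.Monic)
    (hpφ : minpoly ℚ φ = p.map (algebraMap ℤ ℚ)) (hirr : Irreducible (minpoly ℚ φ))
    (hroot : ∀ z ∈ eigs φ, aeval z p = 0) (huni : IsUnimodular φ) :
    ‖∏ z ∈ eigs φ, z‖ * ‖∏ z ∈ otherConjugates φ, z‖ = 1 := by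
  have hmon : (minpoly ℚ φ).Monic := hpφ ▸ hp.map _
  have hsub : eigs φ ⊆ ((minpoly ℚ φ).aroots ℂ).toFinset := by
    intro z hz
    rw [Multiset.mem_toFinset, mem_aroots, hpφ, aeval_map_algebraMap]
    exact ⟨(hp.map _).ne_zero, hroot z hz⟩
  have hnodup : ((minpoly ℚ φ).aroots ℂ).Nodup := nodup_roots (hirr.separable.map)
  have hprod := (IsAlgClosed.splits
    ((minpoly ℚ φ).map (algebraMap ℚ ℂ))).coeff_zero_eq_prod_roots_of_monic (hmon.map _)
  have h1 : ∏ z ∈ ((minpoly ℚ φ).aroots ℂ).toFinset, z = ((minpoly ℚ φ).aroots ℂ).prod := by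
    rw [Finset.prod_multiset_count, Finset.prod_congr rfl]
    intro z hz
    rw [Multiset.count_eq_one_of_mem hnodup (Multiset.mem_toFinset.1 hz), pow_one]
  rw [← norm_mul, mul_comm, otherConjugates, Finset.prod_sdiff hsub, h1]
  have h2 := congrArg norm hprod
  rw [norm_mul, norm_pow, norm_neg, norm_one, one_pow, one_mul, coeff_map] at h2
  rw [aroots, ← h2]
  rcases huni with h | h <;> simp [h]

theorem abs_det_rootMatrix {S : Finset ℂ} (hS : ∀ z ∈ S, (starRingEnd ℂ) z ∈ S) (J : ℕ) :
    |(rootMatrix S J).det| = ‖∏ z ∈ S, z‖ ^ J := by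
  rw [← norm_pow, ← det_rootMatrix hS, Complex.norm_real, Real.norm_eq_abs]

theorem det_eq_det_rootMatrix {σ : Rd d ≃ₗ[ℝ] Physical φ J}
    (hσ : ∀ x, σ (φ x) = (rootMatrix (eigs φ) J).mulVec (σ x)) :
    LinearMap.det φ = (rootMatrix (eigs φ) J).det := by
  rw [← LinearMap.det_toLin', ← LinearMap.det_conj φ σ]
  congr 1
  apply LinearMap.ext
  intro x
  simp [hσ]

/-! ### The lattice -/

theorem polyMap_apply (S : Finset ℂ) (J : ℕ) (f : Fin J → ℤ[X]) :
    polyMap S J f = ∑ j, (aeval (rootMatrix S J) (f j)).mulVec (blockOnes S J j) := rfl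

theorem polyMap_mul (S : Finset ℂ) (J : ℕ) (q : ℤ[X]) (f : Fin J → ℤ[X]) :
    polyMap S J (fun j => q * f j) = (aeval (rootMatrix S J) q).mulVec (polyMap S J f) := by
  rw [polyMap_apply, polyMap_apply, Matrix.mulVec_sum]
  refine Finset.sum_congr rfl fun j _ => ?_
  rw [map_mul, Matrix.mulVec_mulVec]

theorem polyMap_X_mul (S : Finset ℂ) (J : ℕ) (f : Fin J → ℤ[X]) :
    polyMap S J (fun j => X * f j) = (rootMatrix S J).mulVec (polyMap S J f) := by
  rw [polyMap_mul, aeval_X]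

theorem mem_liftedModule_iff (z : Physical φ J × Internal φ J) :
    z ∈ liftedModule φ J ↔
      ∃ f, (polyMap (eigs φ) J f, polyMap (otherConjugates φ) J f) = z := Iff.rfl

/-- As the constant term of the integer polynomial that annihilates both block matrices is a unit,
they act invertibly on the lattice. -/
theorem map_mem_liftedModule_iff {p : ℤ[X]} (hp : p.Monic)
    (hpφ : minpoly ℚ φ = p.map (algebraMap ℤ ℚ)) (hroot : ∀ z ∈ eigs φ, aeval z p = 0)
    (huni : IsUnimodular φ)
    (hB : Function.Injective (rootMatrix (eigs φ) J).mulVec)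
    (hD : Function.Injective (rootMatrix (otherConjugates φ) J).mulVec)
    (z : Physical φ J × Internal φ J) :
    ((rootMatrix (eigs φ) J).mulVec z.1, (rootMatrix (otherConjugates φ) J).mulVec z.2) ∈
      liftedModule φ J ↔ z ∈ liftedModule φ J := by
  constructor
  · intro h
    obtain ⟨f, hf⟩ := (mem_liftedModule_iff _).1 h
    have h1 := congrArg Prod.fst hf
    have h2 := congrArg Prod.snd hf
    dsimp only at h1 h2
    have hcoeff : p.coeff 0 * p.coeff 0 = 1 := by
      rw [IsUnimodular, hpφ, coeff_map] at huni
      have : p.coeff 0 = 1 ∨ p.coeff 0 = -1 := by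
        simp only [algebraMap_int_eq, eq_intCast] at huni
        exact_mod_cast huni
      rcases this with h | h <;> simp [h]
    -- `X * q = 1` modulo `p`
    set q : ℤ[X] := -C (p.coeff 0) * p.divX with hq
    have hXq : X * q = 1 - C (p.coeff 0) * p := by
      have h3 := p.X_mul_divX_add
      have h4 : C (p.coeff 0) * C (p.coeff 0) = (1 : ℤ[X]) := by rw [← C_mul, hcoeff, C_1]
      rw [hq]
      linear_combination (-C (p.coeff 0)) * h3 + h4
    have key : ∀ (S : Finset ℂ), (∀ z ∈ S, (starRingEnd ℂ) z ∈ S) → (∀ z ∈ S, aeval z p = 0) →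
        (rootMatrix S J).mulVec (polyMap S J fun j => q * f j) = polyMap S J f := by
      intro S hS hSp
      have h3 : aeval (rootMatrix S J) p = 0 := by
        rw [← aeval_map_algebraMap ℝ]
        refine aeval_rootMatrix_eq_zero hS J _ fun z hz => ?_
        rw [aeval_map_algebraMap]
        exact hSp z hz
      rw [← polyMap_X_mul]
      simp only [← mul_assoc]
      rw [polyMap_mul, hXq, map_sub, map_mul, h3, mul_zero, sub_zero, map_one, Matrix.one_mulVec]
    refine (mem_liftedModule_iff _).2 ⟨fun j => q * f j, Prod.ext ?_ ?_⟩
    · apply hB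
      rw [← h1]
      exact key _ conj_mem_eigs hroot
    · apply hD
      rw [← h2]
      exact key _ (conj_mem_otherConjugates hp hpφ)
        fun z hz => ((mem_otherConjugates_iff hp hpφ z).1 hz).1
  · intro h
    obtain ⟨f, rfl⟩ := (mem_liftedModule_iff _).1 h
    exact (mem_liftedModule_iff _).2 ⟨fun j => X * f j,
      Prod.ext (polyMap_X_mul _ _ _) (polyMap_X_mul _ _ _)⟩

/-! ### Lifting the control points -/

theorem finite_inter_closedBall_of_separated {E : Type*} [MetricSpace E] [ProperSpace E]
    {s : Set E} {r : ℝ} (hr : 0 < r)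
    (hs : ∀ x ∈ s, ∀ y ∈ s, x ≠ y → r ≤ dist x y) (x : E) (R : ℝ) :
    (Metric.closedBall x R ∩ s).Finite := by
  refine Metric.finite_isBounded_inter_isClosed ⟨?_⟩ Metric.isBounded_closedBall
    (Metric.isClosed_of_pairwise_le_dist hr fun x hx y hy hxy => hs x hx y hy hxy)
  exact DiscreteTopology.of_forall_le_dist hr fun x y hxy =>
    hs x x.2 y y.2 fun h => hxy (Subtype.ext h)

/-- The lift of the `κ`-set `σ(C)` to a subgroup of `X × H`. -/
def liftSet {d κ : ℕ} {X H : Type} [AddCommGroup X] [AddCommGroup H] (L : AddSubgroup (X × H))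
    (σ : Rd d → X) (C : Fin κ → Set (Rd d)) (i : Fin κ) : Set (X × H) :=
  {z | z ∈ L ∧ z.1 ∈ σ '' C i}

theorem modelSet_eq_iff {d κ : ℕ} {X H : Type} [AddCommGroup X] [AddCommGroup H]
    {L : AddSubgroup (X × H)} (hL : Set.InjOn Prod.fst (L : Set (X × H)))
    {σ : Rd d → X} {C : Fin κ → Set (Rd d)} {i : Fin κ}
    (hC : σ '' C i ⊆ Prod.fst '' (L : Set (X × H))) (V : Set H) :
    modelSet L V = σ '' C i ↔ ∀ z ∈ L, z.2 ∈ V ↔ z ∈ liftSet L σ C i := by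
  constructor
  · intro h z hz
    refine ⟨fun hzV => ⟨hz, h ▸ ⟨z, ⟨hz, hzV⟩, rfl⟩⟩, fun hzX => ?_⟩
    have h1 := hzX.2
    rw [← h] at h1
    obtain ⟨w, ⟨hw, hwV⟩, hwz⟩ := h1
    rwa [← hL hw hz hwz]
  · intro h
    apply subset_antisymm
    · rintro _ ⟨z, ⟨hz, hzV⟩, rfl⟩
      exact ((h z hz).1 hzV).2
    · intro p hp
      obtain ⟨z, hz, rfl⟩ := hC hp
      exact ⟨z, ⟨hz, (h z hz).2 ⟨hz, hp⟩⟩, rfl⟩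

/-- The differences of the lifted points generate the lattice, as the first projection is
injective. -/
theorem closure_liftSet_diff {d κ : ℕ} {X H : Type} [AddCommGroup X] [AddCommGroup H]
    {L : AddSubgroup (X × H)} (hL : Set.InjOn Prod.fst (L : Set (X × H)))
    {σ : Rd d →+ X} {C : Fin κ → Set (Rd d)}
    (hC : ∀ i, σ '' C i ⊆ Prod.fst '' (L : Set (X × H)))
    (hgen : AddSubgroup.closure (σ '' differences C) = L.map (AddMonoidHom.fst X H)) :
    AddSubgroup.closure {z | ∃ i, ∃ x ∈ liftSet L σ C i, ∃ y ∈ liftSet L σ C i, z = x - y} = L := by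
  have hle : AddSubgroup.closure
      {z | ∃ i, ∃ x ∈ liftSet L σ C i, ∃ y ∈ liftSet L σ C i, z = x - y} ≤ L := by
    rw [AddSubgroup.closure_le]
    rintro _ ⟨i, x, hx, y, hy, rfl⟩
    exact L.sub_mem hx.1 hy.1
  refine le_antisymm hle fun z hz => ?_
  have h1 : z.1 ∈ AddSubgroup.closure (σ '' differences C) := by
    rw [hgen]; exact ⟨z, hz, rfl⟩
  have h2 : σ '' differences C ⊆ (AddMonoidHom.fst X H) ''
      {z | ∃ i, ∃ x ∈ liftSet L σ C i, ∃ y ∈ liftSet L σ C i, z = x - y} := by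
    rintro _ ⟨_, ⟨i, p, hp, q, hq, rfl⟩, rfl⟩
    obtain ⟨x, hx, hxp⟩ := hC i ⟨p, hp, rfl⟩
    obtain ⟨y, hy, hyq⟩ := hC i ⟨q, hq, rfl⟩
    exact ⟨x - y, ⟨i, x, ⟨hx, p, hp, hxp.symm⟩, y, ⟨hy, q, hq, hyq.symm⟩, rfl⟩, by simp [hxp, hyq]⟩
  have h3 := AddSubgroup.closure_mono h2 h1
  rw [← AddMonoidHom.map_closure] at h3
  obtain ⟨w, hw, hwz⟩ := h3
  rwa [← hL (hle hw) hz hwz]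

theorem finite_lattice_inter {V : Type*} [NormedAddCommGroup V] [ProperSpace V]
    (L : AddSubgroup V) [DiscreteTopology L] (R : ℝ) : {z : V | z ∈ L ∧ ‖z‖ ≤ R}.Finite := by
  have hclosed : IsClosed (L : Set V) := AddSubgroup.isClosed_of_discrete
  have hfin := Metric.finite_isBounded_inter_isClosed (s := (L : Set V)) ⟨inferInstance⟩
    (Metric.isBounded_closedBall (x := (0 : V)) (r := R)) hclosed
  refine hfin.subset fun z hz => ⟨?_, hz.1⟩
  rw [mem_closedBall_zero_iff]
  exact hz.2

/-- The lifted control points form a `LiftedKSet`, for which the volumes of the interiors of the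
prototiles are a subinvariant weight. -/
theorem exists_liftedKSet {d κ J : ℕ} (hd : 0 < d)
    (φ : Module.End ℝ (Rd d)) (hconj : HasConjugateEigenvalues φ J) (huni : IsUnimodular φ)
    (ω : TileSubstitution κ φ) (hprim : ω.IsPrimitive)
    (𝒯 : Set (Tile d κ)) (h𝒯 : ω.IsSubstitutionTiling 𝒯) (hrep : IsRepetitive 𝒯)
    (γ : Tile d κ → Tile d κ) (hγ : ω.IsTileMap 𝒯 γ)
    (c : Tile d κ → Rd d) (hc : IsControlPointMap φ 𝒯 γ c)
    (σ : Rd d ≃ₗ[ℝ] Physical φ J) (hσ : IsRigidifying φ J (controlPoints 𝒯 c) σ)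
    (hL : AddSubgroup.closure (σ '' differences (controlPoints 𝒯 c)) = physicalModule φ J)
    (hCPS : IsCutAndProjectScheme (liftedModule φ J))
    (N : ℕ) (hN : 0 < N) (j : Fin κ) (h0 : 0 ∈ controlPoints 𝒯 c j)
    (hlim : IsKSetLimit
      (fun n => ((kSetSubst φ (controlDigits ω 𝒯 c))^[N])^[n] (originKSet j))
      (controlPoints 𝒯 c))
    (hcoin : ⇑(φ ^ N) '' differences (controlPoints 𝒯 c) ⊆ controlPoints 𝒯 c j) :
    ∃ S : LiftedKSet (Physical φ J) (Internal φ J) (Fin κ),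
      S.lattice = liftedModule φ J ∧
      S.X = liftSet (liftedModule φ J) σ (controlPoints 𝒯 c) ∧
      ∃ w : Fin κ → ℝ, (∀ i, 0 < w i) ∧
        ∀ k, |(S.D : Internal φ J →ₗ[ℝ] Internal φ J).det| *
          ∑ i, (S.digits i k).card * w i ≤ w k := by
  classical
  obtain ⟨p, hp, hpφ, hirr, hroot⟩ := exists_minpoly_eq_map hd hconj hσ.conj
  have hSo := conj_mem_otherConjugates hp hpφ
  have hnorm := norm_prod_mul_norm_prod hp hpφ hirr hroot huni
  -- the determinants of the two block matrices
  have hdet : |LinearMap.det φ| * |(rootMatrix (otherConjugates φ) J).det| = 1 := by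
    rw [det_eq_det_rootMatrix hσ.conj, abs_det_rootMatrix conj_mem_eigs, abs_det_rootMatrix hSo,
      ← mul_pow, hnorm, one_pow]
  have hdetφ : LinearMap.det φ ≠ 0 := fun h => by simp [h] at hdet
  have hdetB : LinearMap.det (Matrix.toLin' (rootMatrix (eigs φ) J)) ≠ 0 := by
    rw [LinearMap.det_toLin', ← det_eq_det_rootMatrix hσ.conj]; exact hdetφ
  have hdetD : LinearMap.det (Matrix.toLin' (rootMatrix (otherConjugates φ) J)) ≠ 0 := by
    rw [LinearMap.det_toLin']; exact fun h => by simp [h] at hdet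
  let B : Physical φ J ≃L[ℝ] Physical φ J :=
    (LinearMap.equivOfDetNeZero _ hdetB).toContinuousLinearEquiv
  let D : Internal φ J ≃L[ℝ] Internal φ J :=
    (LinearMap.equivOfDetNeZero _ hdetD).toContinuousLinearEquiv
  have hB : ∀ v, B v = (rootMatrix (eigs φ) J).mulVec v := fun _ => rfl
  have hBσ : ∀ x, B (σ x) = σ (φ x) := fun x => (hσ.conj x).symm
  have hBσn : ∀ n x, B^[n] (σ x) = σ ((φ ^ n) x) := by
    intro n x
    induction n with
    | zero => rfl
    | succ n ih => rw [Function.iterate_succ_apply', ih, hBσ, pow_succ']; rfl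
  set L := liftedModule φ J with hLdef
  have hmap : ∀ z, B.prodCongr D z ∈ L ↔ z ∈ L :=
    map_mem_liftedModule_iff hp hpφ hroot huni B.injective D.injective
  have hmapn : ∀ n z, z ∈ L → (B.prodCongr D)^[n] z ∈ L := by
    intro n z hz
    induction n with
    | zero => exact hz
    | succ n ih => rw [Function.iterate_succ_apply', hmap]; exact ih
  have hfstn : ∀ n z, ((B.prodCongr D)^[n] z).1 = B^[n] z.1 := by
    intro n z
    induction n with
    | zero => rfl
    | succ n ih => rw [Function.iterate_succ_apply', Function.iterate_succ_apply', ← ih]; rfl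
  have hphys : ∀ x, x ∈ physicalModule φ J ↔ ∃ z ∈ L, z.1 = x := by
    intro x
    constructor
    · rintro ⟨f, rfl⟩; exact ⟨_, ⟨f, rfl⟩, rfl⟩
    · rintro ⟨_, ⟨f, rfl⟩, rfl⟩; exact ⟨f, rfl⟩
  have hphys' : L.map (AddMonoidHom.fst _ _) = physicalModule φ J := by
    ext x; exact (hphys x).symm
  set C := controlPoints 𝒯 c with hC
  have hlift : ∀ i x, x ∈ C i → ∃ z ∈ L, z.1 = σ x := fun i x hx =>
    (hphys _).1 (hσ.subset i ⟨x, hx, rfl⟩)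
  have hliftC : ∀ i, σ '' C i ⊆ Prod.fst '' (L : Set (Physical φ J × Internal φ J)) :=
    fun i x hx => (hphys x).1 (hσ.subset i hx)
  have hfix := kSetSubst_controlPoints h𝒯 hγ hc
  obtain ⟨t, ht⟩ := exists_control_offset h𝒯 hγ hc
  have hne := controlPoints_nonempty h𝒯 hprim hγ hc ⟨0, h0⟩
  -- the lifts of the digits
  have hdig : ∀ i k, ∀ a ∈ controlDigits ω 𝒯 c i k, ∃ z ∈ L, z.1 = σ a := by
    intro i k a ha
    obtain ⟨y, hy⟩ := hne k
    have hx : φ y + a ∈ C i := by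
      rw [hC, ← hfix]; exact ⟨k, a, ha, y, hy, rfl⟩
    obtain ⟨z, hz, hzy⟩ := hlift k y hy
    obtain ⟨z', hz', hzx⟩ := hlift i _ hx
    refine ⟨z' - B.prodCongr D z, L.sub_mem hz' ((hmap z).2 hz), ?_⟩
    change z'.1 - B z.1 = _
    rw [hzx, hzy, hBσ, map_add, add_sub_cancel_left]
  have hdig' : ∀ i k u, ∃ z, u ∈ ω.digits i k → z ∈ L ∧ z.1 = σ (u + t i - φ (t k)) := by
    intro i k u
    by_cases hu : u ∈ ω.digits i k
    · obtain ⟨z, hz⟩ := hdig i k _ ((mem_controlDigits_iff h𝒯 ht i k (hne k) _).2 ⟨u, hu, rfl⟩)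
      exact ⟨z, fun _ => hz⟩
    · exact ⟨0, fun h => absurd h hu⟩
  choose lift hlift' using hdig'
  let dg : Fin κ → Fin κ → Finset (Physical φ J × Internal φ J) :=
    fun i k => (ω.digits i k).image (lift i k)
  have hdg : ∀ i k z, z ∈ dg i k ↔ z ∈ L ∧ ∃ a ∈ controlDigits ω 𝒯 c i k, z.1 = σ a := by
    intro i k z
    simp only [dg, Finset.mem_image]
    constructor
    · rintro ⟨u, hu, rfl⟩
      exact ⟨(hlift' i k u hu).1, _,
        (mem_controlDigits_iff h𝒯 ht i k (hne k) _).2 ⟨u, hu, rfl⟩, (hlift' i k u hu).2⟩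
    · rintro ⟨hz, a, ha, hza⟩
      obtain ⟨u, hu, rfl⟩ := (mem_controlDigits_iff h𝒯 ht i k (hne k) a).1 ha
      exact ⟨u, hu, hCPS.injOn (hlift' i k u hu).1 hz ((hlift' i k u hu).2.trans hza.symm)⟩
  have hcard : ∀ i k, (dg i k).card = (ω.digits i k).card := by
    intro i k
    refine Finset.card_image_of_injOn fun u hu v hv huv => ?_
    have h1 := (hlift' i k u hu).2
    rw [huv, (hlift' i k v hv).2] at h1
    have h2 := σ.injective h1
    simpa using h2.symm
  have hreach : ∀ m i x, x ∈ (kSetSubst φ (controlDigits ω 𝒯 c))^[m] (originKSet j) i →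
      ∃ z ∈ L, z.1 = σ x ∧ DigitReach (B.prodCongr D) (fun i k => (dg i k : Set _)) m i j z := by
    intro m
    induction m with
    | zero =>
      rintro i x ⟨rfl, rfl⟩
      exact ⟨0, L.zero_mem, by simp, DigitReach.refl _⟩
    | succ m ih =>
      intro i x hx
      rw [Function.iterate_succ_apply'] at hx
      obtain ⟨k, a, ha, y, hy, rfl⟩ := hx
      obtain ⟨z, hz, hzy, hr⟩ := ih k y hy
      obtain ⟨b, hb, hba⟩ := hdig i k a ha
      refine ⟨B.prodCongr D z + b, L.add_mem ((hmap z).2 hz) hb, ?_,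
        DigitReach.step ((hdg i k b).2 ⟨hb, a, ha, hba⟩) hr⟩
      change B z.1 + b.1 = _
      rw [hzy, hba, hBσ, map_add]
  let σc : Rd d ≃L[ℝ] Physical φ J := σ.toContinuousLinearEquiv
  let S : LiftedKSet (Physical φ J) (Internal φ J) (Fin κ) :=
    { lattice := L
      B := B
      D := D
      X := liftSet L σ C
      digits := dg
      base := j
      period := N
      period_pos := hN
      finite_inter := by
        have := hCPS.discrete
        exact finite_lattice_inter L
      dense := hCPS.dense
      map_mem_iff := hmap
      mem_lattice := fun i z hz => hz.1
      mem_iff := by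
        intro i z
        constructor
        · rintro ⟨hz, x, hx, hxz⟩
          rw [hC, ← hfix] at hx
          obtain ⟨k, a, ha, y, hy, rfl⟩ := hx
          obtain ⟨v, hv, hvy⟩ := hlift k y hy
          obtain ⟨b, hb, hba⟩ := hdig i k a ha
          refine ⟨k, b, (hdg i k b).2 ⟨hb, a, ha, hba⟩, v, ⟨hv, y, hy, hvy.symm⟩, ?_⟩
          refine hCPS.injOn hz (L.add_mem ((hmap v).2 hv) hb) ?_
          change z.1 = B v.1 + b.1
          rw [hvy, hba, hBσ, ← hxz, map_add]
        · rintro ⟨k, b, hb, v, ⟨hv, y, hy, hyv⟩, rfl⟩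
          obtain ⟨hbL, a, ha, hba⟩ := (hdg i k b).1 hb
          refine ⟨L.add_mem ((hmap v).2 hv) hbL, φ y + a, ?_, ?_⟩
          · rw [hC, ← hfix]; exact ⟨k, a, ha, y, hy, rfl⟩
          · change _ = B v.1 + b.1
            rw [← hyv, hba, hBσ, map_add]
      exists_digit := fun k => by
        obtain ⟨i, hi⟩ := ω.exists_digit k
        exact ⟨i, hi.image _⟩
      zero_mem := ⟨L.zero_mem, 0, h0, by simp⟩
      coincidence := by
        rintro i x ⟨hx, p, hp, hpx⟩ y ⟨hy, q, hq, hqy⟩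
        refine ⟨hmapn N _ (L.sub_mem hx hy), (φ ^ N) (p - q),
          hcoin ⟨_, ⟨i, p, hp, q, hq, rfl⟩, rfl⟩, ?_⟩
        rw [hfstn, Prod.fst_sub, ← hpx, ← hqy, ← map_sub, hBσn]
      reach_base := by
        rintro i x ⟨hx, p, hp, hpx⟩ m
        obtain ⟨n, hn, hnm⟩ := ((hlim i p).and (eventually_ge_atTop m)).exists
        have h1 := hn.2 hp
        dsimp only at h1
        rw [← Function.iterate_mul] at h1
        obtain ⟨z, hz, hzp, hr⟩ := hreach _ i p h1
        refine ⟨N * n, hnm.trans (Nat.le_mul_of_pos_left n hN), ?_⟩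
        rwa [hCPS.injOn hx hz (hpx.symm.trans hzp.symm)]
      exists_reach := by
        intro i k
        refine hprim.induction (p := fun i => ∃ n a, DigitReach (B.prodCongr D)
          (fun i k => (dg i k : Set _)) n i k a) ⟨0, 0, DigitReach.refl k⟩ ?_ i
        rintro i l ⟨u, hu⟩ ⟨n, a, h⟩
        exact ⟨n + 1, _, DigitReach.step (Finset.mem_image_of_mem (lift i l) hu) h⟩
      closure_diff := closure_liftSet_diff (σ := (σ : Rd d →+ Physical φ J)) hCPS.injOn hliftC
        (hL.trans hphys'.symm)
      relDense := by
        obtain ⟨R, hR⟩ := controlPoints_relDense h𝒯 hrep hγ hc ⟨0, h0⟩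
        refine ⟨‖(σc : Rd d →L[ℝ] Physical φ J)‖ * R, fun v => ?_⟩
        obtain ⟨x, hx, hxv⟩ := hR (σ.symm v)
        obtain ⟨z, hz, hzx⟩ := hlift j x hx
        refine ⟨z, ⟨hz, x, hx, hzx.symm⟩, ?_⟩
        have h1 : z.1 - v = σc (x - σ.symm v) := by
          rw [hzx, map_sub]
          exact congrArg _ (σ.apply_symm_apply v).symm
        rw [h1]
        exact ((σc : Rd d →L[ℝ] Physical φ J).le_opNorm _).trans
          (mul_le_mul_of_nonneg_left hxv (norm_nonneg _))
      locFinite := by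
        intro R
        obtain ⟨r, hr, hsep⟩ := controlPoints_separated h𝒯 ht j
        have hfin := finite_inter_closedBall_of_separated hr hsep 0
          (‖(σc.symm : Physical φ J →L[ℝ] Rd d)‖ * R)
        refine Set.Finite.of_injOn (f := Prod.fst) ?_ ?_ (hfin.image σ)
        · rintro z ⟨⟨hz, x, hx, hxz⟩, hzR⟩
          refine ⟨x, ⟨?_, hx⟩, hxz⟩
          have h1 : x = σc.symm z.1 := by
            rw [← hxz]; exact (σ.symm_apply_apply x).symm
          rw [mem_closedBall_zero_iff, h1]
          exact ((σc.symm : Physical φ J →L[ℝ] Rd d).le_opNorm _).trans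
            (mul_le_mul_of_nonneg_left hzR (norm_nonneg _))
        · exact fun x hx y hy hxy => hCPS.injOn hx.1.1 hy.1.1 hxy
      spectrum := by
        have hlin : ∀ (T : Finset ℂ) (q : ℝ[X]),
            aeval (Matrix.toLin' (rootMatrix T J)) q =
              Matrix.toLin' (aeval (rootMatrix T J) q) := fun T q =>
          aeval_algHom_apply (Matrix.toLinAlgEquiv' (R := ℝ)) _ q
        refine ⟨φ.charpoly, ?_, ?_⟩
        · have h1 := hlin (eigs φ) φ.charpoly
          rw [aeval_rootMatrix_eq_zero conj_mem_eigs J _ fun z hz => (mem_eigs_iff z).1 hz,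
            map_zero] at h1
          exact h1
        · have h1 := hlin (otherConjugates φ) φ.charpoly
          have h2 := aeval_rootMatrix_mulVec_injective hSo J φ.charpoly fun z hz h =>
            ((mem_otherConjugates_iff hp hpφ z).1 hz).2 ((mem_eigs_iff z).2 h)
          change Function.Injective (aeval (Matrix.toLin' _) φ.charpoly)
          rw [h1]
          exact h2 }
  refine ⟨S, rfl, rfl, fun i => volume.real (interior (ω.proto i).supp),
    volume_interior_proto_pos ω, fun k => ?_⟩
  have h1 := sum_card_digits_mul_volume_le ω hdetφ k
  have h2 : (S.D : Internal φ J →ₗ[ℝ] Internal φ J).det =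
      (rootMatrix (otherConjugates φ) J).det := LinearMap.det_toLin' _
  change _ * ∑ i, ((dg i k).card : ℝ) * _ ≤ _
  simp only [hcard]
  rw [h2]
  refine (mul_le_mul_of_nonneg_left h1 (abs_nonneg _)).trans_eq ?_
  rw [← mul_assoc, mul_comm |(rootMatrix _ _).det|, hdet, one_mul]

end SubstTiling

end

open SubstTiling in
theorem mainTheorem3 {d κ J : ℕ} (hd : 0 < d)
    (φ : Module.End ℝ (Rd d)) (hexp : IsExpansive φ) (hdiag : IsDiagonalizable φ)
    (hconj : HasConjugateEigenvalues φ J) (huni : IsUnimodular φ)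
    (ω : TileSubstitution κ φ) (hprim : ω.IsPrimitive)
    (𝒯 : Set (Tile d κ)) (h𝒯 : ω.IsSubstitutionTiling 𝒯) (hrep : IsRepetitive 𝒯)
    (γ : Tile d κ → Tile d κ) (hγ : ω.IsTileMap 𝒯 γ)
    (c : Tile d κ → Rd d) (hc : IsControlPointMap φ 𝒯 γ c)
    (σ : Rd d ≃ₗ[ℝ] Physical φ J) (hσ : IsRigidifying φ J (controlPoints 𝒯 c) σ)
    (hL : AddSubgroup.closure (σ '' differences (controlPoints 𝒯 c)) = physicalModule φ J)
    (hCPS : IsCutAndProjectScheme (liftedModule φ J))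
    (N : ℕ) (hN : 0 < N) (j : Fin κ) (h0 : 0 ∈ controlPoints 𝒯 c j)
    (hlim : IsKSetLimit
      (fun n => ((kSetSubst φ (controlDigits ω 𝒯 c))^[N])^[n] (originKSet j))
      (controlPoints 𝒯 c))
    (hcoin : ⇑(φ ^ N) '' differences (controlPoints 𝒯 c) ⊆ controlPoints 𝒯 c j) :
    ∀ i : Fin κ, ∃ U : Set (Internal φ J),
      IsGreatest {V : Set (Internal φ J) | IsOpen V ∧
        modelSet (liftedModule φ J) V = σ '' controlPoints 𝒯 c i} U ∧
      (interior U).Nonempty ∧ IsCompact (closure U) ∧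
      MeasureTheory.volume (frontier U) = 0 := by
  obtain ⟨S, hSL, hSX, w, hw, hwD⟩ := exists_liftedKSet hd φ hconj huni ω hprim 𝒯 h𝒯 hrep γ hγ c hc
    σ hσ hL hCPS N hN j h0 hlim hcoin
  have hsub : ∀ i, σ '' controlPoints 𝒯 c i ⊆
      Prod.fst '' (liftedModule φ J : Set (Physical φ J × Internal φ J)) := by
    intro i x hx
    obtain ⟨f, rfl⟩ := hσ.subset i hx
    exact ⟨_, ⟨f, rfl⟩, rfl⟩
  have hmodel : ∀ i (V : Set (Internal φ J)),
      modelSet (liftedModule φ J) V = σ '' controlPoints 𝒯 c i ↔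
        ∀ z ∈ S.lattice, z.2 ∈ V ↔ z ∈ S.X i := by
    intro i V
    rw [modelSet_eq_iff hCPS.injOn (hsub i), hSL, hSX]
  intro i
  refine ⟨S.window i, ⟨⟨S.isOpen_window i, (hmodel i _).2 fun z hz =>
    ⟨S.mem_of_mem_window hz, S.mem_window⟩⟩, ?_⟩, ?_, S.isCompact_closure_window i,
    S.measure_frontier_window MeasureTheory.volume hw hwD i⟩
  · rintro V ⟨hV, hVX⟩
    exact S.subset_window hV fun z hz hzV => ((hmodel i V).1 hVX z hz).1 hzV
  · obtain ⟨x, hx⟩ := S.X_nonempty i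
    rw [(S.isOpen_window i).interior_eq]
    exact ⟨x.2, S.mem_window hx⟩
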